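/- **Theorem (asymptotic law of the covariance test, complex case).** For $n=1,2,\dots$ let $b_n=A_nx_n+v_n\in\mathbb C^{M_n}$, where $A_n\in\mathbb C^{M_n\times M_n}$ satisfies $A_n^HA_n=I$, $x_n\in\mathbb C^{M_n}$ is deterministic with $S_n$ nonzero entries, and the entries of $v_n$ are independent complex Gaussians whose real and imaginary parts are independent $N(0,\sigma_n^2)$ variables, $\sigma_n>0$. For each $n$ (index suppressed) let $\hat x(\tau)=\arg\min_{z}\tfrac12\|b-Az\|_2^2+\tau\|z\|_1$ be the complex lasso path, let $\tau_1>\tau_2>\cdots$ be its knots (the points $\tau>0$ at which the slope of $\hat x(\cdot)$ changes), and let $$T_k=\frac1{\sigma^2}\Big(b^HA\hat x(\tau_{k+1})-b^HA_J\tilde x_J(\tau_{k+1})\Big)$$ be the covariance test statistic, where $J$ is the active set just before $\tau_k$ (the indices of the nonzero entries of $\hat x(\tau)$ for $\tau$ slightly larger than $\tau_k$) and $\tilde x_J(\tau)$ is the complex lasso solution that uses only the columns $A_J$ of $A$ with index in $J$. Let $B$ be the event that every variable $i$ with $x_i\neq0$ enters the lasso path (as $\tau$ decreases) strictly before every variable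 $j$ with $x_j=0$. Suppose that the smallest nonzero entry of $x_n$ in modulus is large compared to $\sigma_n$, in the sense that $$\min_{j:\,(x_n)_j\ne0}\frac{|(x_n)_j|}{\sigma_n}-\sqrt{2\log M_n}-\sqrt{2\log S_n}\;\longrightarrow\;\infty\qquad(n\to\infty)$$ (the condition is void for those $n$ with $S_n=0$; if $S_n$ is bounded the last term may be omitted; $M_n$ may be constant, in which case the condition says that $\min_{j:\,(x_n)_j\neq 0}|(x_n)_j|/\sigma_n\to\infty$). Then $\mathbb P(B_n)\to1$. If moreover $M_n-S_n\to\infty$ (for fixed $S$: $M_n\to\infty$), then for each fixed $l\ge0$, conditionally on $B_n$, $$(T_{S_n+1},T_{S_n+2},\dots,T_{S_n+l})\xrightarrow{d}(E_1,E_2,\dots,E_l),$$ where $E_1,\dots,E_l$ are independent and $E_k$ is exponential with mean $1/k$. -/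

import Mathlib

open MeasureTheory ProbabilityTheory Filter Topology Matrix

noncomputable section

namespace CovTest

variable {m n : Type*} [Fintype m] [Fintype n]

/-- The complex lasso objective `½ ‖b - A x‖₂² + τ ‖x‖₁`. -/
def lassoObjective (A : Matrix m n ℂ) (b : m → ℂ) (τ : ℝ) (x : n → ℂ) : ℝ :=
  1 / 2 * ∑ i, ‖b i - (A *ᵥ x) i‖ ^ 2 + τ * ∑ j, ‖x j‖

/-- `x` solves the lasso problem at `τ` that uses only the columns of `A` with index in `J`
(coefficient vectors are extended by zero outside `J`). -/
def IsLassoSolution (A : Matrix m n ℂ) (b : m → ℂ) (J : Set n) (τ : ℝ) (x : n → ℂ) : Prop :=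
  (∀ j ∉ J, x j = 0) ∧ IsMinOn (lassoObjective A b τ) {y | ∀ j ∉ J, y j = 0} x

/-- The solution of the lasso problem at `τ` on the columns in `J`. For `Aᴴ A = 1` and `τ ≥ 0`
the solution exists and is unique. -/
def lassoRestricted (A : Matrix m n ℂ) (b : m → ℂ) (J : Set n) (τ : ℝ) : n → ℂ :=
  Classical.epsilon (IsLassoSolution A b J τ)

/-- The lasso path `τ ↦ x̂(τ)`. -/
def lassoPath (A : Matrix m n ℂ) (b : m → ℂ) (τ : ℝ) : n → ℂ :=
  lassoRestricted A b Set.univ τ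

/-- The set of knots: the points `τ > 0` at which the slope of the lasso path changes. -/
def knotSet (A : Matrix m n ℂ) (b : m → ℂ) : Set ℝ :=
  {τ | 0 < τ ∧ ¬ DifferentiableAt ℝ (lassoPath A b) τ}

/-- The `k`-th knot `τ_k` (`k = 1, 2, …`), i.e. the `k`-th largest element of `knotSet A b`:
the largest knot `t` such that at least `k` knots are `≥ t` (and `0` if there are fewer than
`k` knots). -/
def knot (A : Matrix m n ℂ) (b : m → ℂ) (k : ℕ) : ℝ :=
  sSup {t | t ∈ knotSet A b ∧ (k : ℕ∞) ≤ (knotSet A b ∩ Set.Ici t).encard}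

/-- The active set just before `t` on the path, which is run with decreasing `τ`: the indices
whose coefficient is nonzero at all `τ > t` close to `t`. -/
def activeBefore (A : Matrix m n ℂ) (b : m → ℂ) (t : ℝ) : Set n :=
  {j | ∀ᶠ τ in 𝓝[>] t, lassoPath A b τ j ≠ 0}

/-- The covariance test statistic at the `k`-th knot,
`T_k = (bᴴ A x̂(τ_{k+1}) - bᴴ A_J x̃_J(τ_{k+1})) / σ²`, where `J` is the active set just
before `τ_k` and `x̃_J` is the lasso solution on the columns in `J`.
(By the optimality conditions both inner products are real.) -/
def covStat (A : Matrix m n ℂ) (b : m → ℂ) (σ : ℝ) (k : ℕ) : ℝ :=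
  1 / σ ^ 2 *
    (star b ⬝ᵥ (A *ᵥ lassoPath A b (knot A b (k + 1)))
      - star b ⬝ᵥ (A *ᵥ lassoRestricted A b (activeBefore A b (knot A b k))
          (knot A b (k + 1)))).re

/-- The point of the path at which variable `j` enters: the supremum of the `τ ≥ 0` with
`x̂_j(τ) ≠ 0` (and `0` if there are none). -/
def entryPoint (A : Matrix m n ℂ) (b : m → ℂ) (j : n) : ℝ :=
  sSup {τ | 0 ≤ τ ∧ lassoPath A b τ j ≠ 0}

/-- The condition defining the event `B`: every variable in the support of the true parameter
`x` enters the path strictly before every variable outside the support. -/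
def SourcesEnterFirst (A : Matrix m n ℂ) (b : m → ℂ) (x : n → ℂ) : Prop :=
  ∀ i, x i ≠ 0 → ∀ j, x j = 0 → entryPoint A b j < entryPoint A b i

/-- The number `S` of nonzero entries of `x`. -/
def numSources (x : n → ℂ) : ℕ := (Function.support x).ncard

/-- The law of a circular complex Gaussian variable whose real and imaginary parts are
independent, each `N(0, σ²)`; its modulus divided by `σ` has c.d.f. `1 - exp (-r² / 2)`. -/
def complexGaussian (σ : ℝ) : Measure ℂ :=
  ((gaussianReal 0 (σ ^ 2).toNNReal).prod (gaussianReal 0 (σ ^ 2).toNNReal)).map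
    Complex.measurableEquivRealProd.symm

/-- White complex Gaussian noise in `ℂ^M`: independent `complexGaussian σ` coordinates. -/
def noiseLaw (M : ℕ) (σ : ℝ) : Measure (Fin M → ℂ) :=
  Measure.pi fun _ => complexGaussian σ

/-- The conditional law of `X` given the event `B`. -/
def condLaw {Ω E : Type*} [MeasurableSpace Ω] [MeasurableSpace E] (P : Measure Ω)
    (B : Set Ω) (X : Ω → E) : FiniteMeasure E :=
  ⟨(P[|B]).map X, inferInstance⟩

/-- The joint law of `l` independent exponential variables, the `k`-th one (`k = 1, …, l`)
having mean `1 / k`, that is, rate `k`. -/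
def expLaw (l : ℕ) : FiniteMeasure (Fin l → ℝ) :=
  ⟨Measure.pi fun k : Fin l => expMeasure ((k : ℝ) + 1), by
    have (k : Fin l) : IsProbabilityMeasure (expMeasure ((k : ℝ) + 1)) :=
      isProbabilityMeasure_expMeasure (by positivity)
    infer_instance⟩

end CovTest

end

/-! Since `A` is square, `Aᴴ A = 1` makes it unitary. With `β = Aᴴ b = x + Aᴴ v` the lasso objective
splits into scalar problems, so the path is coordinatewise soft thresholding of `β`
(`lassoRestricted_eq`). Variable `j` enters at `‖β j‖`, the knots are the positive moduli, and for
distinct positive moduli `r₁ > r₂ > ⋯` all terms of the covariance statistic but one vanish: `T_k =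
r_k (r_k - r_{k+1}) / σ²` (`covStat_eq_of_rank`).

The noise `w = Aᴴ v` has the law of `v` (`noiseLaw_map_mulVec`). A union bound keeps all `‖w j‖`
below `σ (√(2 log M) + c)` and those on the support below `σ (√(2 log S) + c)`, outside an event of
probability at most `2 exp(-c²/2)`; sources of larger modulus than the sum of both bounds then come
first, so `P(B) → 1`.

On `B` the moduli after the first `S` are pure noise, and `‖w j‖² / (2σ²)` are independent standard
exponentials. Let `U₁ > U₂ > ⋯ > U_N` be their order statistics and `D_k = U_k - U_{k+1}`, with
`U_{N+1} = 0`. Then `T_{S+k} = √(2U_k) (√(2U_k) - √(2U_{k+1})) = 2 D_k / (1 + √(U_{k+1}/U_k))`. By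
Rényi's representation (`lintegral_pi_expMeasure_eq_tailSum`) the `D_k` are independent with rates
`k`. Realising all `N` on one sequence `D`, the tails `U_{k+1} = D_{k+1} + ⋯ + D_N` diverge almost
surely, the ratio tends to 1 and the statistic tends to `D_k`. Conditioning on `B` does not alter
the limit because `P(B) → 1`. -/

noncomputable section

namespace CovTest

/-! ### The scalar complex lasso -/

/-- Complex soft thresholding. -/
def softThreshold (τ : ℝ) (z : ℂ) : ℂ := ((max (‖z‖ - τ) 0 / ‖z‖ : ℝ) : ℂ) * z

lemma norm_softThreshold {τ : ℝ} (hτ : 0 ≤ τ) (z : ℂ) :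
    ‖softThreshold τ z‖ = max (‖z‖ - τ) 0 := by
  rcases eq_or_ne z 0 with rfl | hz
  · simp [softThreshold, hτ]
  · have : 0 < ‖z‖ := norm_pos_iff.mpr hz
    rw [softThreshold, norm_mul, Complex.norm_real, Real.norm_of_nonneg (by positivity)]
    field_simp

lemma softThreshold_ne_zero {τ : ℝ} (hτ : 0 ≤ τ) (z : ℂ) :
    softThreshold τ z ≠ 0 ↔ τ < ‖z‖ := by
  rw [← norm_pos_iff, norm_softThreshold hτ]
  simp

/-- Soft thresholding keeps the phase, so pairing with `z` gives a real number. This reduces both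
the kinks of the path and the covariance statistic to real expressions in the moduli. -/
lemma star_mul_softThreshold {τ : ℝ} (z : ℂ) :
    star z * softThreshold τ z = ((‖z‖ * max (‖z‖ - τ) 0 : ℝ) : ℂ) := by
  rcases eq_or_ne z 0 with rfl | hz
  · simp [softThreshold]
  · have : (‖z‖ : ℂ) ≠ 0 := by exact_mod_cast (norm_pos_iff.mpr hz).ne'
    have h2 : star z * z = (‖z‖ : ℂ) ^ 2 := by
      simpa using Complex.conj_mul' z
    rw [softThreshold, mul_left_comm, h2]
    push_cast
    field_simp

lemma softThreshold_eq_zero_of_le {τ : ℝ} {z : ℂ} (h : ‖z‖ ≤ τ) : softThreshold τ z = 0 := by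
  simp [softThreshold, h]

/-- Strong convexity of the scalar lasso objective at its minimiser. -/
lemma scalar_objective_ge {τ : ℝ} (hτ : 0 ≤ τ) (β z : ℂ) :
    1 / 2 * ‖β - softThreshold τ β‖ ^ 2 + τ * ‖softThreshold τ β‖
      + 1 / 2 * ‖z - softThreshold τ β‖ ^ 2 ≤ 1 / 2 * ‖β - z‖ ^ 2 + τ * ‖z‖ := by
  set s := softThreshold τ β with hs
  -- The optimality condition: `β - s` is `τ` times a subgradient of the norm at `s`.
  have key : inner ℝ (β - s) z ≤ τ * ‖z‖ ∧ inner ℝ (β - s) s = τ * ‖s‖ := by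
    have hn := norm_softThreshold hτ β
    rcases le_or_gt ‖β‖ τ with h | h
    · have h0 : s = 0 := softThreshold_eq_zero_of_le h
      refine ⟨?_, by simp [h0]⟩
      rw [h0, sub_zero]
      exact (real_inner_le_norm _ _).trans (by gcongr)
    · have hp : 0 < ‖β‖ := hτ.trans_lt h
      have hm : max (‖β‖ - τ) 0 = ‖β‖ - τ := max_eq_left (by linarith)
      have h1 : s = ((‖β‖ - τ) / ‖β‖) • β := by
        rw [hs, softThreshold, hm, Complex.real_smul]
      have h2 : β - s = (τ / ‖β‖) • β := by
        rw [h1, ← one_smul ℝ β, smul_smul, ← sub_smul, one_smul]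
        congr 1; field_simp; ring
      constructor
      · refine (real_inner_le_norm _ _).trans ?_
        rw [h2, norm_smul, Real.norm_of_nonneg (by positivity)]
        gcongr
        field_simp
        exact le_rfl
      · rw [← hs, hm] at hn
        rw [h2, h1, real_inner_smul_left, real_inner_smul_right, real_inner_self_eq_norm_sq,
          ← h1, hn]
        field_simp
  have e : β - z = (β - s) - (z - s) := by ring
  rw [e, @norm_sub_sq_real _ _ _ (β - s) (z - s), inner_sub_right]
  linarith [key.1, key.2]

/-! ### The lasso path for a unitary design -/

section Path

variable {n : Type*} [Fintype n] [DecidableEq n] {A : Matrix n n ℂ} (hA : Aᴴ * A = 1) (b : n → ℂ)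
include hA

lemma sum_norm_sq_mulVec (y : n → ℂ) :
    ∑ i, ‖(A *ᵥ y) i‖ ^ 2 = ∑ i, ‖y i‖ ^ 2 := by
  have h (u : n → ℂ) : ((∑ i, ‖u i‖ ^ 2 : ℝ) : ℂ) = star u ⬝ᵥ u := by
    simp [dotProduct, Complex.conj_mul']
  have : ((∑ i, ‖(A *ᵥ y) i‖ ^ 2 : ℝ) : ℂ) = ((∑ i, ‖y i‖ ^ 2 : ℝ) : ℂ) := by
    rw [h, h, star_mulVec, dotProduct_mulVec, vecMul_vecMul, hA, vecMul_one]
  exact_mod_cast this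

lemma lassoObjective_eq (τ : ℝ) (y : n → ℂ) :
    lassoObjective A b τ y = ∑ j, (1 / 2 * ‖(Aᴴ *ᵥ b) j - y j‖ ^ 2 + τ * ‖y j‖) := by
  have hA' : A * Aᴴ = 1 := mul_eq_one_comm.mp hA
  have hb : b = A *ᵥ (Aᴴ *ᵥ b) := by rw [mulVec_mulVec, hA', one_mulVec]
  have : ∑ i, ‖b i - (A *ᵥ y) i‖ ^ 2 = ∑ i, ‖(Aᴴ *ᵥ b) i - y i‖ ^ 2 := by
    have := sum_norm_sq_mulVec hA (Aᴴ *ᵥ b - y)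
    rw [mulVec_sub, ← hb] at this
    exact this
  rw [lassoObjective, this, Finset.sum_add_distrib, Finset.mul_sum, Finset.mul_sum]

open Classical in
-- The quadratic gap of `scalar_objective_ge`, summed over the coordinates, gives uniqueness as well
-- as minimality; uniqueness is what identifies the solution chosen by `Classical.epsilon`.
lemma lassoRestricted_eq (J : Set n) {τ : ℝ} (hτ : 0 ≤ τ) :
    lassoRestricted A b J τ =
      fun j => if j ∈ J then softThreshold τ ((Aᴴ *ᵥ b) j) else 0 := by
  set s : n → ℂ := fun j => if j ∈ J then softThreshold τ ((Aᴴ *ᵥ b) j) else 0 with hs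
  have hs0 : ∀ j ∉ J, s j = 0 := fun j hj => by simp [hs, hj]
  have ge (y : n → ℂ) (hy : ∀ j ∉ J, y j = 0) :
      lassoObjective A b τ s + 1 / 2 * ∑ j, ‖y j - s j‖ ^ 2 ≤ lassoObjective A b τ y := by
    rw [lassoObjective_eq hA, lassoObjective_eq hA, Finset.mul_sum, ← Finset.sum_add_distrib]
    refine Finset.sum_le_sum fun j _ => ?_
    by_cases hj : j ∈ J
    · simp only [hs, hj, if_true]
      exact scalar_objective_ge hτ _ _
    · simp [hs0 j hj, hy j hj]
  have hsol : IsLassoSolution A b J τ s := by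
    refine ⟨hs0, fun y hy => ?_⟩
    have : 0 ≤ ∑ j, ‖y j - s j‖ ^ 2 := by positivity
    have := ge y hy
    simp only [Set.mem_ofPred_eq]
    linarith
  have hε : IsLassoSolution A b J τ (lassoRestricted A b J τ) := Classical.epsilon_spec ⟨s, hsol⟩
  have h1 := ge _ hε.1
  have h2 : lassoObjective A b τ (lassoRestricted A b J τ) ≤ lassoObjective A b τ s := hε.2 hs0
  have h3 : ∑ j, ‖lassoRestricted A b J τ j - s j‖ ^ 2 = 0 :=
    le_antisymm (by linarith) (by positivity)
  rw [Finset.sum_eq_zero_iff_of_nonneg (fun _ _ => by positivity)] at h3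
  funext j
  simpa [sub_eq_zero] using h3 j (Finset.mem_univ j)

lemma lassoPath_eq {τ : ℝ} (hτ : 0 ≤ τ) :
    lassoPath A b τ = fun j => softThreshold τ ((Aᴴ *ᵥ b) j) := by
  rw [lassoPath, lassoRestricted_eq hA b _ hτ]
  simp

lemma entryPoint_eq (j : n) : entryPoint A b j = ‖(Aᴴ *ᵥ b) j‖ := by
  have : {τ | 0 ≤ τ ∧ lassoPath A b τ j ≠ 0} = Set.Ico 0 ‖(Aᴴ *ᵥ b) j‖ := by
    ext τ
    refine and_congr_right fun hτ => ?_
    rw [lassoPath_eq hA b hτ]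
    exact softThreshold_ne_zero hτ _
  rw [entryPoint, this]
  rcases (norm_nonneg ((Aᴴ *ᵥ b) j)).eq_or_lt with h | h
  -- Here the interval is empty and `sSup ∅ = 0` is the right value.
  · simp [← h]
  · exact csSup_Ico h

lemma activeBefore_eq {t : ℝ} (ht : 0 ≤ t) :
    activeBefore A b t = {j | t < ‖(Aᴴ *ᵥ b) j‖} := by
  ext j
  have : (∀ᶠ τ in 𝓝[>] t, lassoPath A b τ j ≠ 0) ↔
      ∀ᶠ τ in 𝓝[>] t, τ < ‖(Aᴴ *ᵥ b) j‖ := by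
    refine eventually_congr ?_
    filter_upwards [self_mem_nhdsWithin] with τ hτ
    have h0 : 0 ≤ τ := ht.trans (le_of_lt hτ)
    rw [lassoPath_eq hA b h0]
    exact softThreshold_ne_zero h0 _
  simp only [activeBefore, Set.mem_ofPred_eq, this]
  constructor
  · intro h
    obtain ⟨τ, h1, h2⟩ := (h.and self_mem_nhdsWithin).exists
    exact lt_trans h2 h1
  · intro h
    filter_upwards [Ioo_mem_nhdsGT h] with τ hτ using hτ.2

lemma knotSet_eq : knotSet A b = {t | 0 < t ∧ ∃ j, ‖(Aᴴ *ᵥ b) j‖ = t} := by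
  ext t
  refine and_congr_right fun ht => ?_
  have heq : lassoPath A b =ᶠ[𝓝 t] fun τ j => softThreshold τ ((Aᴴ *ᵥ b) j) := by
    filter_upwards [Ioi_mem_nhds ht] with τ hτ using lassoPath_eq hA b (le_of_lt hτ)
  rw [heq.differentiableAt_iff, ← not_iff_not, not_not, differentiableAt_pi]
  push Not
  refine forall_congr' fun j => ?_
  set β := (Aᴴ *ᵥ b) j
  constructor
  · rintro h rfl
    have h1 : DifferentiableAt ℝ (fun τ => (star β * softThreshold τ β).re) ‖β‖ :=
      Complex.reCLM.differentiableAt.comp _ (h.const_mul (star β))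
    simp only [star_mul_softThreshold, Complex.ofReal_re] at h1
    -- Differentiability at `‖β‖` would carry over to the absolute value at 0, by `|x| = 2 max(-x,
    -- 0) + x`.
    have h2 : DifferentiableAt ℝ (fun x : ℝ => |x|) 0 := by
      have h3 : DifferentiableAt ℝ
          (fun x : ℝ => 2 * (‖β‖⁻¹ * (‖β‖ * max (‖β‖ - (x + ‖β‖)) 0)) + x) 0 := by
        have : DifferentiableAt ℝ (fun x : ℝ => ‖β‖ * max (‖β‖ - (x + ‖β‖)) 0) 0 :=
          DifferentiableAt.comp (f := fun x : ℝ => x + ‖β‖) 0 (by simpa using h1) (by fun_prop)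
        fun_prop
      convert h3 using 1
      funext x
      rw [inv_mul_cancel_left₀ ht.ne', show ‖β‖ - (x + ‖β‖) = -x by ring]
      rcases le_total 0 x with hx | hx
      · rw [abs_of_nonneg hx, max_eq_right (by linarith)]; ring
      · rw [abs_of_nonpos hx, max_eq_left (by linarith)]; ring
    exact not_differentiableAt_abs_zero h2
  · intro h
    rcases lt_or_gt_of_ne h with h | h
    · have : (fun τ => softThreshold τ β) =ᶠ[𝓝 t] fun _ => 0 := by
        filter_upwards [Ioi_mem_nhds h] with τ hτ using softThreshold_eq_zero_of_le (le_of_lt hτ)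
      exact this.differentiableAt_iff.mpr (differentiableAt_const _)
    · have : (fun τ => softThreshold τ β) =ᶠ[𝓝 t] fun τ => ((‖β‖ - τ) / ‖β‖) • β := by
        filter_upwards [Iio_mem_nhds h] with τ hτ
        rw [softThreshold, max_eq_left (by linarith [show τ < ‖β‖ from hτ]), Complex.real_smul]
      refine this.differentiableAt_iff.mpr ?_
      fun_prop

/-- Full and restricted solutions agree on the active set, so only coordinates of modulus at most
`τ_k` survive in the difference. -/
lemma covStat_eq (σ : ℝ) (k : ℕ) (h0 : 0 ≤ knot A b k) (h1 : 0 ≤ knot A b (k + 1)) :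
    covStat A b σ k = 1 / σ ^ 2 * ∑ j, if ‖(Aᴴ *ᵥ b) j‖ ≤ knot A b k then
      ‖(Aᴴ *ᵥ b) j‖ * max (‖(Aᴴ *ᵥ b) j‖ - knot A b (k + 1)) 0 else 0 := by
  have hs : star b ᵥ* A = star (Aᴴ *ᵥ b) := by rw [star_mulVec, conjTranspose_conjTranspose]
  rw [covStat, dotProduct_mulVec, dotProduct_mulVec, hs, ← dotProduct_sub, lassoPath_eq hA b h1,
    lassoRestricted_eq hA b _ h1, activeBefore_eq hA b h0, dotProduct, Complex.re_sum]
  congr 1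
  refine Finset.sum_congr rfl fun j _ => ?_
  by_cases h : ‖(Aᴴ *ᵥ b) j‖ ≤ knot A b k
  · rw [if_pos h, ← Complex.ofReal_re (_ * _), ← star_mul_softThreshold]
    simp [not_lt.mpr h]
  · rw [if_neg h]
    simp [not_le.mp h]

end Path

/-! ### Ranks and order statistics -/

section OrderStat

variable {ι κ : Type*} [Fintype ι] [Fintype κ]

/-- The number of coordinates of `r` that exceed the `i`-th one. -/
def rank (r : ι → ℝ) (i : ι) : ℕ := (Finset.univ.filter fun j => r i < r j).card

/-- The `k`-th largest coordinate of `r`, counted from `0`, for `r` with distinct coordinates. -/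
def orderStat (r : ι → ℝ) (k : ℕ) : ℝ := ∑ i, if rank r i = k then r i else 0

lemma rank_lt_rank {r : ι → ℝ} {i j : ι} (h : r i < r j) : rank r j < rank r i := by
  refine Finset.card_lt_card ⟨fun a => ?_, fun hs => ?_⟩
  · simpa using h.trans
  · have := @hs j (by simpa using h)
    simp at this

lemma rank_lt_card (r : ι → ℝ) (i : ι) : rank r i < Fintype.card ι := by
  refine Finset.card_lt_univ_of_notMem (x := i) ?_
  simp

lemma rank_injective {r : ι → ℝ} (hr : Function.Injective r) : Function.Injective (rank r) := by
  intro i j hij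
  by_contra h
  rcases lt_or_gt_of_ne (hr.ne h) with h' | h'
  · exact (rank_lt_rank h').ne' hij
  · exact (rank_lt_rank h').ne hij

lemma exists_rank_eq {r : ι → ℝ} (hr : Function.Injective r) {k : ℕ} (hk : k < Fintype.card ι) :
    ∃ i, rank r i = k := by
  have : Function.Bijective fun i => (⟨rank r i, rank_lt_card r i⟩ : Fin (Fintype.card ι)) := by
    rw [Fintype.bijective_iff_injective_and_card]
    exact ⟨fun i j h => rank_injective hr (by simpa using h), by simp⟩
  obtain ⟨i, hi⟩ := this.2 ⟨k, hk⟩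
  exact ⟨i, by simpa using hi⟩

lemma orderStat_eq_of_rank {r : ι → ℝ} (hr : Function.Injective r) {i : ι} {k : ℕ}
    (h : rank r i = k) : orderStat r k = r i := by
  rw [orderStat, Finset.sum_eq_single i]
  · simp [h]
  · intro j _ hj
    rw [if_neg]
    exact fun h' => hj (rank_injective hr (h'.trans h.symm))
  · simp

lemma rank_comp_equiv (r : ι → ℝ) (e : κ ≃ ι) (i : κ) : rank (r ∘ e) i = rank r (e i) := by
  rw [rank, rank, ← Finset.card_map e.toEmbedding]
  congr 1
  ext j
  simp [Finset.mem_map_equiv]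

lemma orderStat_comp_equiv (r : ι → ℝ) (e : κ ≃ ι) (k : ℕ) :
    orderStat (r ∘ e) k = orderStat r k := by
  simp only [orderStat, rank_comp_equiv]
  exact e.sum_comp fun i => if rank r i = k then r i else 0

lemma measurable_rank (i : ι) : Measurable fun r : ι → ℝ => rank r i := by
  simp only [rank, Finset.card_filter]
  refine Finset.measurable_sum _ fun j _ => Measurable.ite ?_ measurable_const measurable_const
  exact measurableSet_lt (measurable_pi_apply i) (measurable_pi_apply j)

lemma measurable_orderStat (k : ℕ) : Measurable fun r : ι → ℝ => orderStat r k := by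
  refine Finset.measurable_sum _ fun i _ => Measurable.ite ?_ (measurable_pi_apply i)
    measurable_const
  exact measurable_rank i (measurableSet_singleton k)

/-- With `e` enumerating the non-sources, this is the index shift by `S` on the event `B`. -/
lemma rank_eq_add_rank_comp {r : ι → ℝ} {e : κ → ι} (he : Function.Injective e)
    (h : ∀ i ∉ Set.range e, ∀ j, r (e j) < r i) (i : κ) :
    rank r (e i) = (Set.range e)ᶜ.ncard + rank (r ∘ e) i := by
  classical
  have h1 : (Finset.univ.filter fun j => r (e i) < r j) =
      (Set.range e)ᶜ.toFinset ∪ (Finset.univ.filter fun j => (r ∘ e) i < (r ∘ e) j).image e := by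
    ext j
    by_cases hj : j ∈ Set.range e
    · obtain ⟨j, rfl⟩ := hj
      simp [he.eq_iff]
    · simp [h j hj i]
      exact Or.inl fun x hx => hj ⟨x, hx⟩
  rw [rank, h1, Finset.card_union_of_disjoint, Finset.card_image_of_injective _ he, rank,
    Set.ncard_eq_toFinset_card']
  rw [Finset.disjoint_left]
  intro a ha hb
  simp only [Set.mem_toFinset, Set.mem_compl_iff] at ha
  obtain ⟨j, _, rfl⟩ := Finset.mem_image.mp hb
  exact ha ⟨j, rfl⟩

end OrderStat

/-- The limiting form of the test statistic in terms of two consecutive order statistics of the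
normalised squared moduli. -/
def gapStat (a b : ℝ) : ℝ := √(2 * a) * (√(2 * a) - √(2 * b))

/-! ### Knots and statistics in terms of ranked moduli -/

section RankedKnots

variable {n : Type*} [Fintype n] [DecidableEq n] {A : Matrix n n ℂ} (hA : Aᴴ * A = 1) {b : n → ℂ}
include hA

lemma knot_eq_of_rank {r : n → ℝ} (hr : r = fun j => ‖(Aᴴ *ᵥ b) j‖)
    (hpos : ∀ j, 0 < r j) (hinj : Function.Injective r) {i : n} {k : ℕ} (hi : rank r i = k) :
    knot A b (k + 1) = r i := by
  have hK : knotSet A b = Set.range r := by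
    rw [knotSet_eq hA]
    ext t
    constructor
    · rintro ⟨_, j, rfl⟩; exact ⟨j, by rw [hr]⟩
    · rintro ⟨j, rfl⟩; exact ⟨hpos j, j, by rw [hr]⟩
  -- Ranks count from 0 and knots from 1: the extra 1 is the knot `r j` itself.
  have hcard (j : n) : (knotSet A b ∩ Set.Ici (r j)).encard = (rank r j + 1 : ℕ) := by
    have : knotSet A b ∩ Set.Ici (r j) =
        (insert j (Finset.univ.filter fun j' => r j < r j')).image r := by
      rw [hK]
      ext t
      simp only [Set.mem_inter_iff, Set.mem_range, Set.mem_Ici, Finset.coe_image, Set.mem_image,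
        Finset.coe_insert, Set.mem_insert_iff, Finset.mem_coe, Finset.mem_filter,
        Finset.mem_univ, true_and]
      constructor
      · rintro ⟨⟨a, rfl⟩, ha⟩
        rcases ha.eq_or_lt with h | h
        · exact ⟨j, Or.inl rfl, h⟩
        · exact ⟨a, Or.inr h, rfl⟩
      · rintro ⟨a, rfl | ha, rfl⟩
        · exact ⟨⟨_, rfl⟩, le_rfl⟩
        · exact ⟨⟨_, rfl⟩, ha.le⟩
    rw [this, Set.encard_coe_eq_coe_finsetCard, Finset.card_image_of_injective _ hinj,
      Finset.card_insert_of_notMem (by simp)]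
    rfl
  refine IsGreatest.csSup_eq ⟨⟨hK ▸ ⟨i, rfl⟩, ?_⟩, ?_⟩
  · rw [hcard, hi]
  · rintro t ⟨ht, htk⟩
    obtain ⟨j, rfl⟩ := hK ▸ ht
    rw [hcard] at htk
    by_contra! hlt
    have := rank_lt_rank hlt
    have : k + 1 ≤ rank r j + 1 := by exact_mod_cast htk
    omega

/-- No modulus lies strictly between two consecutive knots, so every coordinate below `τ_k` is still
thresholded to zero at `τ_{k+1}`, and `i` alone contributes. -/
lemma covStat_eq_of_rank {r : n → ℝ} (hr : r = fun j => ‖(Aᴴ *ᵥ b) j‖)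
    (hpos : ∀ j, 0 < r j) (hinj : Function.Injective r) {i i' : n} {k : ℕ} (hi : rank r i = k)
    (hi' : rank r i' = k + 1) (σ : ℝ) :
    covStat A b σ (k + 1) = 1 / σ ^ 2 * (r i * (r i - r i')) := by
  have e1 := knot_eq_of_rank hA hr hpos hinj hi
  have e2 := knot_eq_of_rank hA hr hpos hinj hi'
  rw [covStat_eq hA b σ (k + 1) (by rw [e1]; exact (hpos i).le) (by rw [e2]; exact (hpos i').le),
    e1, e2]
  have hrj (j : n) : ‖(Aᴴ *ᵥ b) j‖ = r j := by rw [hr]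
  simp only [hrj]
  have hlt : r i' < r i := by
    by_contra! h
    rcases h.eq_or_lt with h | h
    · rw [hinj h] at hi; omega
    · have := rank_lt_rank h; omega
  rw [Finset.sum_eq_single i]
  · rw [if_pos le_rfl, max_eq_left (by linarith)]
  · intro j _ hj
    split_ifs with h
    · have h1 : r j < r i := lt_of_le_of_ne h (hinj.ne hj)
      have h2 : r j ≤ r i' := by
        by_contra! h3
        have := rank_lt_rank h1
        have := rank_lt_rank h3
        omega
      rw [max_eq_right (by linarith), mul_zero]
    · rfl
  · simp

lemma covStat_eq_gapStat {x : n → ℂ} {N : ℕ} {e : Fin N → n} (he : Function.Injective e)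
    (hrange : Set.range e = {j | x j = 0}) {σ : ℝ} (hσ : 0 < σ) {u : Fin N → ℝ}
    (hu : ∀ i, ‖(Aᴴ *ᵥ b) (e i)‖ = σ * √(2 * u i)) (hu0 : ∀ i, 0 ≤ u i)
    (hpos : ∀ j, 0 < ‖(Aᴴ *ᵥ b) j‖) (hinj : Function.Injective fun j => ‖(Aᴴ *ᵥ b) j‖)
    (hB : SourcesEnterFirst A b x) {k : ℕ} (hk : k + 1 < N) :
    covStat A b σ (numSources x + (k + 1)) = gapStat (orderStat u k) (orderStat u (k + 1)) := by
  set r : n → ℝ := fun j => ‖(Aᴴ *ᵥ b) j‖ with hr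
  have hu_inj : Function.Injective u := fun i j hij => he (hinj (by simp only [hr, hu, hij]))
  have hu_lt (i j : Fin N) : (r ∘ e) i < (r ∘ e) j ↔ u i < u j := by
    simp only [Function.comp, hr, hu]
    rw [mul_lt_mul_iff_right₀ hσ, Real.sqrt_lt_sqrt_iff (by linarith [hu0 i]),
      mul_lt_mul_iff_right₀ two_pos]
  have hrank (i : Fin N) : rank (r ∘ e) i = rank u i := by simp only [rank, hu_lt]
  have hS : (Set.range e)ᶜ.ncard = numSources x := by
    rw [hrange, numSources]; rfl
  have hfirst : ∀ i ∉ Set.range e, ∀ j, r (e j) < r i := by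
    intro i hi j
    have := hB i (by simpa [hrange] using hi) (e j) (by
      have : e j ∈ Set.range e := ⟨j, rfl⟩
      rwa [hrange] at this)
    rwa [entryPoint_eq hA, entryPoint_eq hA] at this
  obtain ⟨i, hi⟩ := exists_rank_eq hu_inj (k := k) (by simpa using by omega)
  obtain ⟨i', hi'⟩ := exists_rank_eq hu_inj (k := k + 1) (by simpa using hk)
  have h1 : rank r (e i) = numSources x + k := by
    rw [rank_eq_add_rank_comp he hfirst, hrank, hi, hS]
  have h2 : rank r (e i') = numSources x + k + 1 := by
    rw [rank_eq_add_rank_comp he hfirst, hrank, hi', hS, add_assoc]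
  rw [← add_assoc, covStat_eq_of_rank hA hr hpos hinj h1 h2, orderStat_eq_of_rank hu_inj hi,
    orderStat_eq_of_rank hu_inj hi', gapStat]
  simp only [hr, hu]
  field_simp

end RankedKnots

/-! ### Exponential laws -/

section Exponential

variable {r : ℝ}

instance nullSingletonClass_expMeasure : NullSingletonClass (expMeasure r) := by
  unfold expMeasure gammaMeasure
  infer_instance

lemma expMeasure_Ici (hr : 0 < r) (t : ℝ) :
    expMeasure r (Set.Ici t) = ENNReal.ofReal (Real.exp (-(r * max t 0))) := by
  have := isProbabilityMeasure_expMeasure hr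
  have h1 : (Set.Iic t)ᶜ = Set.Ioi t := Set.compl_Iic
  have h2 : expMeasure r (Set.Iic t) = ENNReal.ofReal (if 0 ≤ t then 1 - Real.exp (-(r * t)) else 0) := by
    rw [← cdf_expMeasure_eq hr, ofReal_cdf]
  rw [← Ioi_ae_eq_Ici.measure_eq, ← h1, prob_compl_eq_one_sub measurableSet_Iic, h2,
    ← ENNReal.ofReal_one, ← ENNReal.ofReal_sub]
  · congr 1
    split_ifs with h
    · rw [max_eq_left h]; ring
    · rw [max_eq_right (le_of_not_ge h)]; simp
  · split_ifs with h
    · have : Real.exp (-(r * t)) ≤ 1 := Real.exp_le_one_iff.mpr (by nlinarith)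
      linarith
    · exact le_rfl

lemma eq_expMeasure_of_Ici (hr : 0 < r) {μ : Measure ℝ} [IsProbabilityMeasure μ]
    (h : ∀ t, μ (Set.Ici t) = ENNReal.ofReal (Real.exp (-(r * max t 0)))) : μ = expMeasure r := by
  have := isProbabilityMeasure_expMeasure hr
  exact Measure.ext_of_Ici _ _ fun t => by rw [h, expMeasure_Ici hr]

lemma ae_pos_expMeasure (hr : 0 < r) : ∀ᵐ x ∂expMeasure r, 0 < x := by
  have := isProbabilityMeasure_expMeasure hr
  have h : expMeasure r (Set.Ioi 0) = 1 := by
    rw [Ioi_ae_eq_Ici.measure_eq, expMeasure_Ici hr]; simp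
  exact (prob_compl_eq_zero_iff measurableSet_Ioi).mpr h

/-- Memorylessness, in unnormalised form. -/
lemma expMeasure_restrict_Ioi (hr : 0 < r) {t : ℝ} (ht : 0 ≤ t) :
    (expMeasure r).restrict (Set.Ioi t) =
      ENNReal.ofReal (Real.exp (-(r * t))) • (expMeasure r).map (· + t) := by
  have := isProbabilityMeasure_expMeasure hr
  have hm : Measurable fun x : ℝ => x + t := by fun_prop
  rw [restrict_Ioi_eq_restrict_Ici]
  refine Measure.ext_of_Ici _ _ fun c => ?_
  rw [Measure.restrict_apply measurableSet_Ici, Measure.smul_apply,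
    Measure.map_apply hm measurableSet_Ici, Set.Ici_inter_Ici, smul_eq_mul,
    show (fun x : ℝ => x + t) ⁻¹' Set.Ici c = Set.Ici (c - t) by ext; simp,
    expMeasure_Ici hr, expMeasure_Ici hr, ← ENNReal.ofReal_mul (by positivity), ← Real.exp_add]
  congr 2
  change -(r * max (max c t) 0) = _
  rcases le_total c t with h | h
  · rw [max_eq_right h, max_eq_left ht, max_eq_right (by linarith : c - t ≤ 0)]; ring
  · rw [max_eq_left h, max_eq_left (ht.trans h), max_eq_left (by linarith : 0 ≤ c - t)]; ring

lemma lintegral_expMeasure_eq {g : ℝ → ENNReal} (hg : Measurable g) :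
    ∫⁻ t, g t ∂expMeasure r =
      ∫⁻ t, ENNReal.ofReal (r * Real.exp (-((r - 1) * t))) * g t ∂expMeasure 1 := by
  have hpdf (s : ℝ) : Measurable (gammaPDF 1 s) := (measurable_gammaPDFReal 1 s).ennreal_ofReal
  unfold expMeasure gammaMeasure
  rw [lintegral_withDensity_eq_lintegral_mul _ (hpdf _) hg,
    lintegral_withDensity_eq_lintegral_mul _ (hpdf _) (by fun_prop)]
  refine lintegral_congr fun t => ?_
  change exponentialPDF r t * _ = exponentialPDF 1 t * _
  rw [← mul_assoc, exponentialPDF_eq, exponentialPDF_eq]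
  congr 1
  split_ifs with h
  · rw [← ENNReal.ofReal_mul (by positivity)]
    congr 1
    rw [mul_left_comm, one_mul, ← Real.exp_add]
    congr 2; ring
  · simp

end Exponential

/-! ### Almost sure absence of ties -/

section Distinct

variable {ι : Type*} [Fintype ι] {μ : ι → Measure ℝ} [∀ i, IsProbabilityMeasure (μ i)]
  [∀ i, NullSingletonClass (μ i)]

lemma ae_injective_pi : ∀ᵐ u ∂Measure.pi μ, Function.Injective u := by
  have h (i j : ι) (hij : i ≠ j) : ∀ᵐ u ∂Measure.pi μ, u i ≠ u j := by
    have hind : IndepFun (fun u : ι → ℝ => u i) (fun u => u j) (Measure.pi μ) :=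
      (iIndepFun_pi (X := fun _ x => x) fun _ => aemeasurable_id).indepFun hij
    have hi := (measurePreserving_eval μ i).map_eq
    have hj := (measurePreserving_eval μ j).map_eq
    have hmap : (Measure.pi μ).map (fun u => (u i, u j)) = (μ i).prod (μ j) := by
      rw [(indepFun_iff_map_prod_eq_prod_map_map (measurable_pi_apply i).aemeasurable
        (measurable_pi_apply j).aemeasurable).mp hind]
      exact congrArg₂ Measure.prod hi hj
    have hdiag : MeasurableSet {p : ℝ × ℝ | p.1 = p.2} :=
      measurableSet_eq_fun measurable_fst measurable_snd
    have h0 : ((μ i).prod (μ j)) {p | p.1 = p.2} = 0 := by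
      rw [Measure.measure_prod_null hdiag]
      refine Eventually.of_forall fun x => ?_
      have : Prod.mk x ⁻¹' {p : ℝ × ℝ | p.1 = p.2} = {x} := by ext y; simp [eq_comm]
      exact (congrArg (μ j) this).trans (measure_singleton x)
    rw [← hmap, Measure.map_apply (by fun_prop) hdiag] at h0
    simpa [ae_iff] using h0
  have : ∀ᵐ u ∂Measure.pi μ, ∀ i j : ι, i ≠ j → u i ≠ u j := by
    refine ae_all_iff.mpr fun i => ae_all_iff.mpr fun j => ?_
    by_cases hij : i = j
    · simp [hij]
    · filter_upwards [h i j hij] with u hu _ using hu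
  filter_upwards [this] with u hu i j hij
  by_contra hne
  exact hu i j hne hij

end Distinct

/-! ### Rényi's representation -/

section Renyi

lemma lintegral_pi_insertNth {N : ℕ} (μ : Fin (N + 1) → Measure ℝ) [∀ i, SigmaFinite (μ i)]
    (i : Fin (N + 1)) {F : (Fin (N + 1) → ℝ) → ENNReal} (hF : Measurable F) :
    ∫⁻ u, F u ∂Measure.pi μ =
      ∫⁻ t, ∫⁻ u, F (i.insertNth t u) ∂(Measure.pi fun j => μ (i.succAbove j)) ∂μ i := by
  have h := (measurePreserving_piFinSuccAbove μ i).symm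
  rw [← h.lintegral_comp hF, lintegral_prod]
  · rfl
  · exact (hF.comp h.measurable).aemeasurable

lemma measurable_insertNth_prod {N : ℕ} (i : Fin (N + 1)) :
    Measurable fun p : ℝ × (Fin N → ℝ) => (i.insertNth p.1 p.2 : Fin (N + 1) → ℝ) :=
  (MeasurableEquiv.piFinSuccAbove (fun _ : Fin (N + 1) => ℝ) i).symm.measurable

/-- `D ↦ (D k + D (k + 1) + ⋯)_k`. -/
def tailSum {N : ℕ} (D : Fin N → ℝ) (k : Fin N) : ℝ := ∑ i, if k ≤ i then D i else 0

lemma measurable_tailSum {N : ℕ} : Measurable (tailSum (N := N)) := by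
  refine measurable_pi_lambda _ fun k => Finset.measurable_sum _ fun i _ => ?_
  split_ifs
  · exact measurable_pi_apply i
  · exact measurable_const

/-- The last increment is the minimum and shifts all other tail sums; this is the recursion produced
by splitting off the smallest variable. -/
lemma tailSum_snoc {N : ℕ} (D : Fin N → ℝ) (t : ℝ) :
    tailSum (Fin.snoc D t : Fin (N + 1) → ℝ) =
      (Fin.snoc (fun k => tailSum D k + t) t : Fin (N + 1) → ℝ) := by
  funext k
  refine Fin.lastCases ?_ (fun k => ?_) k
  · simp only [tailSum, Fin.sum_univ_castSucc, Fin.snoc_castSucc, Fin.snoc_last, le_refl, if_true]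
    rw [Finset.sum_eq_zero, zero_add]
    intro i _
    rw [if_neg (not_le.mpr (Fin.castSucc_lt_last i))]
  · simp only [tailSum, Fin.sum_univ_castSucc, Fin.snoc_castSucc, Fin.snoc_last,
      Fin.castSucc_le_castSucc_iff, Fin.le_last, if_true]

/-- Invariance under permutations of the coordinates. -/
def IsSymm {ι α : Type*} (f : (ι → ℝ) → α) : Prop := ∀ (e : Equiv.Perm ι) u, f (u ∘ e) = f u

lemma IsSymm.insertNth {N : ℕ} {α : Type*} {f : (Fin (N + 1) → ℝ) → α} (hf : IsSymm f)
    (i : Fin (N + 1)) (t : ℝ) (u : Fin N → ℝ) :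
    f (i.insertNth t u) = f (Fin.snoc u t) := by
  rw [← hf ((finSuccEquiv' (Fin.last N)).trans (finSuccEquiv' i).symm)]
  congr 1
  funext j
  refine Fin.lastCases ?_ (fun j => ?_) j
  · simp
  · rw [Function.comp, Equiv.trans_apply, ← Fin.succAbove_last_apply, finSuccEquiv'_succAbove]
    simp

lemma lintegral_pi_expMeasure_indicator {N : ℕ} {t : ℝ} (ht : 0 ≤ t)
    {F : (Fin N → ℝ) → ENNReal} (hF : Measurable F) :
    ∫⁻ u, {u | ∀ i, t < u i}.indicator F u ∂(Measure.pi fun _ : Fin N => expMeasure 1) =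
      ENNReal.ofReal (Real.exp (-(N * t))) *
        ∫⁻ u, F (fun i => u i + t) ∂(Measure.pi fun _ : Fin N => expMeasure 1) := by
  have := isProbabilityMeasure_expMeasure one_pos
  have hm : Measurable fun (u : Fin N → ℝ) i => u i + t := by fun_prop
  have hset : {u : Fin N → ℝ | ∀ i, t < u i} = Set.univ.pi fun _ => Set.Ioi t := by ext; simp
  have hmeas : (Measure.pi fun _ : Fin N => expMeasure 1).restrict (Set.univ.pi fun _ => Set.Ioi t)
      = ENNReal.ofReal (Real.exp (-(N * t))) •
        (Measure.pi fun _ : Fin N => expMeasure 1).map fun u i => u i + t := by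
    rw [Measure.restrict_pi_pi]
    refine Measure.pi_eq fun s hs => ?_
    have : IsProbabilityMeasure ((expMeasure 1).map (· + t)) :=
      Measure.isProbabilityMeasure_map (by fun_prop)
    rw [Measure.pi_map_pi (f := fun _ x => x + t) (fun _ => by fun_prop), Measure.smul_apply, Measure.pi_pi,
      expMeasure_restrict_Ioi one_pos ht]
    simp only [Measure.smul_apply, smul_eq_mul, Finset.prod_mul_distrib, Finset.prod_const,
      Finset.card_univ, Fintype.card_fin]
    rw [← ENNReal.ofReal_pow (by positivity), ← Real.exp_nat_mul]
    congr 3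
    ring_nf
  rw [hset, lintegral_indicator (MeasurableSet.univ_pi fun _ => measurableSet_Ioi), hmeas,
    lintegral_smul_measure, lintegral_map hF hm, smul_eq_mul]

/-- Splitting off the smallest of independent standard exponential variables. -/
lemma lintegral_pi_expMeasure_succ {N : ℕ} {f : (Fin (N + 1) → ℝ) → ENNReal} (hf : Measurable f)
    (hs : IsSymm f) :
    ∫⁻ u, f u ∂(Measure.pi fun _ : Fin (N + 1) => expMeasure 1) =
      ∫⁻ t, ∫⁻ u, f (Fin.snoc (fun i => u i + t) t)
        ∂(Measure.pi fun _ : Fin N => expMeasure 1) ∂expMeasure (N + 1) := by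
  have := isProbabilityMeasure_expMeasure one_pos
  set μ := Measure.pi fun _ : Fin (N + 1) => expMeasure 1
  set ν := Measure.pi fun _ : Fin N => expMeasure 1
  have hsnoc : Measurable fun p : ℝ × (Fin N → ℝ) => (Fin.snoc p.2 p.1 : Fin (N + 1) → ℝ) := by
    simpa [Fin.insertNth_last'] using measurable_insertNth_prod (Fin.last N)
  have hinner : Measurable fun t : ℝ => ∫⁻ u, f (Fin.snoc (fun i => u i + t) t) ∂ν := by
    refine Measurable.lintegral_prod_right' (f := fun p : ℝ × (Fin N → ℝ) =>
      f (Fin.snoc (fun i => p.2 i + p.1) p.1)) (hf.comp ?_)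
    exact hsnoc.comp (g := fun p : ℝ × (Fin N → ℝ) => (Fin.snoc p.2 p.1 : Fin (N + 1) → ℝ))
      (f := fun p : ℝ × (Fin N → ℝ) => (p.1, fun i => p.2 i + p.1)) (by fun_prop)
  -- On `E i` the strict minimum sits at `i`; as ties are null, these disjoint events cover almost
  -- everything.
  set E : Fin (N + 1) → Set (Fin (N + 1) → ℝ) := fun i => {u | ∀ j, j ≠ i → u i < u j}
  have hE (i) : MeasurableSet (E i) := by
    have : E i = ⋂ j, ⋂ (_ : j ≠ i), {u | u i < u j} := by ext; simp [E]
    rw [this]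
    exact .iInter fun j => .iInter fun _ =>
      measurableSet_lt (measurable_pi_apply i) (measurable_pi_apply j)
  have hsplit : ∫⁻ u, f u ∂μ = ∑ i, ∫⁻ u, (E i).indicator f u ∂μ := by
    rw [← lintegral_finsetSum _ fun i _ => hf.indicator (hE i)]
    refine lintegral_congr_ae ?_
    filter_upwards [ae_injective_pi (μ := fun _ : Fin (N + 1) => expMeasure 1)] with u hu
    obtain ⟨i, hi⟩ := Finite.exists_min u
    rw [Finset.sum_eq_single i]
    · rw [Set.indicator_of_mem]
      exact fun j hj => lt_of_le_of_ne (hi j) (hu.ne hj.symm)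
    · intro j _ hj
      rw [Set.indicator_of_notMem]
      exact fun h => (h i hj.symm).not_ge (hi j)
    · simp
  have hterm (i : Fin (N + 1)) : ∫⁻ u, (E i).indicator f u ∂μ =
      ∫⁻ t, ENNReal.ofReal (Real.exp (-(N * t))) *
        ∫⁻ u, f (Fin.snoc (fun i => u i + t) t) ∂ν ∂expMeasure 1 := by
    rw [lintegral_pi_insertNth _ i (hf.indicator (hE i))]
    refine lintegral_congr_ae ?_
    filter_upwards [ae_pos_expMeasure one_pos] with t ht
    rw [← lintegral_pi_expMeasure_indicator (F := fun u => f (Fin.snoc u t)) ht.le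
      (hf.comp (hsnoc.comp (by fun_prop : Measurable fun u : Fin N → ℝ => (t, u))))]
    refine lintegral_congr fun u => ?_
    have hiff : (i.insertNth t u : Fin (N + 1) → ℝ) ∈ E i ↔ u ∈ {u : Fin N → ℝ | ∀ i, t < u i} := by
      simp only [E, Set.mem_ofPred_eq]
      constructor
      · intro h j
        simpa using h (i.succAbove j) (Fin.succAbove_ne i j)
      · intro h j hj
        obtain ⟨j, rfl⟩ := Fin.exists_succAbove_eq hj
        simpa using h j
    by_cases h : u ∈ {u : Fin N → ℝ | ∀ i, t < u i}
    · rw [Set.indicator_of_mem (hiff.mpr h), Set.indicator_of_mem h, hs.insertNth]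
    · rw [Set.indicator_of_notMem (mt hiff.mp h), Set.indicator_of_notMem h]
  -- By symmetry the `N + 1` terms coincide, and `(N + 1) exp(-N t)` is the density of the rate `N +
  -- 1` law with respect to the rate 1 law.
  rw [hsplit, Finset.sum_congr rfl fun i _ => hterm i, Finset.sum_const, Finset.card_univ,
    Fintype.card_fin, lintegral_expMeasure_eq hinner, nsmul_eq_mul,
    ← lintegral_const_mul _ (by fun_prop)]
  refine lintegral_congr fun t => ?_
  rw [← mul_assoc, ENNReal.ofReal_mul (by positivity)]
  congr 2
  · exact_mod_cast (ENNReal.ofReal_natCast (N + 1)).symm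
  · simp

/-- **Rényi's representation** of the order statistics of exponential variables. -/
lemma lintegral_pi_expMeasure_eq_tailSum {N : ℕ} {f : (Fin N → ℝ) → ENNReal} (hf : Measurable f)
    (hs : IsSymm f) :
    ∫⁻ u, f u ∂(Measure.pi fun _ : Fin N => expMeasure 1) =
      ∫⁻ D, f (tailSum D) ∂(Measure.pi fun i : Fin N => expMeasure ((i : ℝ) + 1)) := by
  have hp (i : ℕ) : IsProbabilityMeasure (expMeasure ((i : ℝ) + 1)) :=
    isProbabilityMeasure_expMeasure (by positivity)
  induction N with
  | zero =>
    rw [show (fun _ : Fin 0 => expMeasure 1) = fun i : Fin 0 => expMeasure ((i : ℝ) + 1) from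
      Subsingleton.elim _ _]
    exact lintegral_congr fun D => by rw [Subsingleton.elim (tailSum D) D]
  | succ N ih =>
    have hsnoc : Measurable fun p : ℝ × (Fin N → ℝ) => (Fin.snoc p.2 p.1 : Fin (N + 1) → ℝ) := by
      simpa [Fin.insertNth_last'] using measurable_insertNth_prod (Fin.last N)
    rw [lintegral_pi_expMeasure_succ hf hs,
      lintegral_pi_insertNth (F := fun D => f (tailSum D)) _ (Fin.last N)
        (hf.comp measurable_tailSum)]
    simp only [Fin.val_last, Fin.succAbove_last, Fin.val_castSucc, Fin.insertNth_last',
      tailSum_snoc]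
    refine lintegral_congr fun t => ?_
    refine ih (f := fun u => f (Fin.snoc (fun i => u i + t) t)) ?_ fun e u => ?_
    · exact hf.comp (hsnoc.comp
        (by fun_prop : Measurable fun u : Fin N → ℝ => (t, fun i => u i + t)))
    -- `e` extended by fixing the last index, so that symmetry of `f` passes to the remaining `N`
    -- variables.
    · let e' : Equiv.Perm (Fin (N + 1)) :=
        (finSuccEquiv' (Fin.last N)).trans
          ((Equiv.optionCongr e).trans (finSuccEquiv' (Fin.last N)).symm)
      refine Eq.trans ?_ (hs e' _)
      refine congrArg f ?_
      funext j
      refine Fin.lastCases ?_ (fun j => ?_) j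
      · simp [e']
      · simp only [e', Function.comp, Equiv.trans_apply]
        rw [← Fin.succAbove_last_apply, finSuccEquiv'_succAbove]
        simp [Fin.succAbove_last_apply]

lemma rank_eq_val_of_strictAnti {N : ℕ} {u : Fin N → ℝ} (hu : StrictAnti u) (k : Fin N) :
    rank u k = k := by
  simp only [rank, hu.lt_iff_gt]
  rw [Finset.filter_gt_eq_Iio, Fin.card_Iio]

lemma strictAnti_tailSum {N : ℕ} {D : Fin N → ℝ} (hD : ∀ i, 0 < D i) : StrictAnti (tailSum D) := by
  intro k k' h
  refine Finset.sum_lt_sum (fun i _ => ?_) ⟨k, Finset.mem_univ k, ?_⟩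
  · split_ifs with h1 h2
    · exact le_rfl
    · exact absurd (h.le.trans h1) h2
    · exact (hD i).le
    · exact le_rfl
  · rw [if_neg (not_le.mpr h), if_pos le_rfl]
    exact hD k

lemma orderStat_tailSum {N : ℕ} {D : Fin N → ℝ} (hD : ∀ i, 0 < D i) (k : Fin N) :
    orderStat (tailSum D) k = tailSum D k :=
  orderStat_eq_of_rank (strictAnti_tailSum hD).injective
    (rank_eq_val_of_strictAnti (strictAnti_tailSum hD) k)

end Renyi

instance isProbabilityMeasure_complexGaussian (σ : ℝ) :
    IsProbabilityMeasure (complexGaussian σ) :=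
  Measure.isProbabilityMeasure_map Complex.measurableEquivRealProd.symm.measurable.aemeasurable

instance isProbabilityMeasure_noiseLaw (M : ℕ) (σ : ℝ) :
    IsProbabilityMeasure (noiseLaw M σ) := by
  unfold noiseLaw; infer_instance

/-! ### Unitary invariance of circular noise -/

section Unitary

lemma charFunDual_gaussianReal (σ : ℝ) (L : StrongDual ℝ ℝ) :
    charFunDual (gaussianReal 0 (σ ^ 2).toNNReal) L =
      Complex.exp (-(σ ^ 2 * L 1 ^ 2 / 2 : ℝ)) := by
  obtain ⟨a, ha⟩ : ∃ a, L 1 = a := ⟨_, rfl⟩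
  have hL (x : ℝ) : L x = a * x := by
    have := L.map_smul x 1
    simp only [smul_eq_mul, mul_one] at this
    rw [this, ha, mul_comm]
  have h := charFun_gaussianReal (μ := 0) (v := (σ ^ 2).toNNReal) a
  rw [charFun_apply_real] at h
  rw [charFunDual_apply, ha]
  simp only [hL, Complex.ofReal_mul]
  rw [h, Real.coe_toNNReal _ (sq_nonneg σ)]
  congr 1
  push_cast
  ring

lemma charFunDual_complexGaussian (σ : ℝ) (L : StrongDual ℝ ℂ) :
    charFunDual (complexGaussian σ) L =
      Complex.exp (-(σ ^ 2 * (L 1 ^ 2 + L Complex.I ^ 2) / 2 : ℝ)) := by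
  have h : complexGaussian σ = ((gaussianReal 0 (σ ^ 2).toNNReal).prod
      (gaussianReal 0 (σ ^ 2).toNNReal)).map
        (Complex.equivRealProdCLM.symm : (ℝ × ℝ) →L[ℝ] ℂ) := rfl
  have h1 : Complex.equivRealProdCLM.symm (1, 0) = 1 := by
    apply Complex.ext <;> simp
  have h2 : Complex.equivRealProdCLM.symm (0, 1) = Complex.I := by
    apply Complex.ext <;> simp
  rw [h, charFunDual_map, charFunDual_prod, charFunDual_gaussianReal, charFunDual_gaussianReal,
    ← Complex.exp_add]
  simp only [ContinuousLinearMap.comp_apply, ContinuousLinearMap.inl_apply,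
    ContinuousLinearMap.inr_apply, ContinuousLinearEquiv.coe_coe, h1, h2]
  congr 1
  push_cast
  ring

lemma charFunDual_noiseLaw (M : ℕ) (σ : ℝ) (L : StrongDual ℝ (Fin M → ℂ)) :
    charFunDual (noiseLaw M σ) L =
      Complex.exp (-(σ ^ 2 * ∑ j, (L (Pi.single j 1) ^ 2 + L (Pi.single j Complex.I) ^ 2) / 2
        : ℝ)) := by
  rw [noiseLaw, charFunDual_pi]
  simp only [charFunDual_complexGaussian, ← Complex.exp_sum]
  congr 1
  rw [Finset.mul_sum]
  push_cast
  rw [Finset.sum_neg_distrib]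
  congr 1
  refine Finset.sum_congr rfl fun j _ => ?_
  simp only [Function.comp_apply, ContinuousLinearMap.single_apply]
  ring

/-- Circular white noise is invariant under unitary maps. -/
lemma noiseLaw_map_mulVec {M : ℕ} (σ : ℝ) {U : Matrix (Fin M) (Fin M) ℂ} (hU : U * Uᴴ = 1) :
    (noiseLaw M σ).map (fun w => U *ᵥ w) = noiseLaw M σ := by
  let T : (Fin M → ℂ) →L[ℝ] (Fin M → ℂ) :=
    ((Matrix.mulVecLin U).restrictScalars ℝ).toContinuousLinearMap
  have hT : (fun w => U *ᵥ w) = T := rfl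
  rw [hT]
  have : IsProbabilityMeasure ((noiseLaw M σ).map T) :=
    Measure.isProbabilityMeasure_map T.continuous.measurable.aemeasurable
  refine Measure.ext_of_charFunDual (funext fun L => ?_)
  rw [charFunDual_map, charFunDual_noiseLaw, charFunDual_noiseLaw]
  -- `c` represents `L` as `z ↦ Re ⟨c, z⟩`. Composing with `U` replaces `c` by `Uᴴ c`, and the
  -- characteristic function sees only the Euclidean norm of `c`.
  set c : Fin M → ℂ := fun j => ⟨L (Pi.single j 1), L (Pi.single j Complex.I)⟩ with hc
  have hL (z : Fin M → ℂ) : L z = (∑ j, star (c j) * z j).re := by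
    have hz : z = ∑ j, ((z j).re • (Pi.single j 1 : Fin M → ℂ) +
        (z j).im • (Pi.single j Complex.I : Fin M → ℂ)) := by
      funext i
      rw [Finset.sum_apply, Finset.sum_eq_single i]
      · apply Complex.ext <;> simp
      · intro j _ hj
        simp [Pi.single_eq_of_ne hj.symm]
      · simp
    conv_lhs => rw [hz]
    rw [map_sum, Complex.re_sum]
    refine Finset.sum_congr rfl fun j _ => ?_
    simp [hc]
    ring
  have hU' (j : Fin M) (a : ℂ) :
      L (T (Pi.single j a)) = (star ((Uᴴ *ᵥ c) j) * a).re := by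
    rw [hL]
    congr 1
    have : T (Pi.single j a) = fun i => U i j * a := by
      rw [← hT]
      funext i
      simp [Matrix.mulVec_single]
    simp only [this, mulVec, dotProduct, conjTranspose_apply, star_sum, Finset.sum_mul, star_mul',
      star_star]
    exact Finset.sum_congr rfl fun i _ => by ring
  have hsum := sum_norm_sq_mulVec (A := Uᴴ)
    (by rw [conjTranspose_conjTranspose, hU]) c
  have e1 (j : Fin M) : L (T (Pi.single j 1)) ^ 2 + L (T (Pi.single j Complex.I)) ^ 2 =
      ‖(Uᴴ *ᵥ c) j‖ ^ 2 := by
    rw [hU', hU', ← Complex.normSq_eq_norm_sq, Complex.normSq_apply]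
    simp
    ring
  have e2 (j : Fin M) : L (Pi.single j 1) ^ 2 + L (Pi.single j Complex.I) ^ 2 = ‖c j‖ ^ 2 := by
    rw [← Complex.normSq_eq_norm_sq, Complex.normSq_apply]
    ring
  simp only [ContinuousLinearMap.comp_apply, e1, e2, ← Finset.sum_div, hsum]

end Unitary

/-! ### Moduli of complex Gaussians -/

section Density

variable {σ : ℝ}

lemma lintegral_complexGaussian (hσ : 0 < σ) {F : ℂ → ENNReal} (hF : Measurable F) :
    ∫⁻ z, F z ∂complexGaussian σ =
      ∫⁻ z, ENNReal.ofReal ((2 * Real.pi * σ ^ 2)⁻¹ * Real.exp (-‖z‖ ^ 2 / (2 * σ ^ 2))) * F z := by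
  have hv : (σ ^ 2).toNNReal ≠ 0 := by simpa using hσ.ne'
  have hvc : (((σ ^ 2).toNNReal : NNReal) : ℝ) = σ ^ 2 := Real.coe_toNNReal _ (sq_nonneg σ)
  have hpdf := measurable_gaussianPDF 0 (σ ^ 2).toNNReal
  have hmp := Complex.volume_preserving_equiv_real_prod.symm
  rw [complexGaussian, lintegral_map_equiv, gaussianReal_of_var_ne_zero _ hv, prod_withDensity hpdf hpdf,
    lintegral_withDensity_eq_lintegral_mul
      (g := fun p => F (Complex.measurableEquivRealProd.symm p)) _ (by fun_prop)
      (hF.comp Complex.measurableEquivRealProd.symm.measurable),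
    ← hmp.lintegral_comp_emb Complex.measurableEquivRealProd.symm.measurableEmbedding]
  refine lintegral_congr fun p => ?_
  have hn : ‖Complex.measurableEquivRealProd.symm p‖ ^ 2 = p.1 ^ 2 + p.2 ^ 2 := by
    rw [← Complex.normSq_eq_norm_sq, Complex.normSq_apply]
    simp [Complex.measurableEquivRealProd]
    ring
  rw [hn, Pi.mul_apply]
  congr 1
  rw [gaussianPDF, gaussianPDF, ← ENNReal.ofReal_mul (gaussianPDFReal_nonneg _ _ _)]
  congr 1
  simp only [gaussianPDFReal_def, hvc, sub_zero]
  have : (√(2 * Real.pi * σ ^ 2))⁻¹ * (√(2 * Real.pi * σ ^ 2))⁻¹ = (2 * Real.pi * σ ^ 2)⁻¹ := by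
    rw [← mul_inv, Real.mul_self_sqrt (by positivity)]
  rw [mul_mul_mul_comm, this, ← Real.exp_add]
  congr 2
  ring

lemma complexGaussian_absolutelyContinuous (hσ : 0 < σ) : complexGaussian σ ≪ volume := by
  refine Measure.AbsolutelyContinuous.mk fun s hs h0 => ?_
  rw [← lintegral_indicator_one hs, lintegral_complexGaussian hσ (measurable_one.indicator hs)]
  refine (lintegral_congr_ae ?_).trans lintegral_zero
  filter_upwards [measure_eq_zero_iff_ae_notMem.mp h0] with z hz
  simp [hz]

lemma lintegral_rayleigh (hσ : 0 < σ) {ρ : ℝ} (hρ : 0 ≤ ρ) :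
    ∫⁻ r in Set.Ioi ρ, ENNReal.ofReal (r / σ ^ 2 * Real.exp (-r ^ 2 / (2 * σ ^ 2))) =
      ENNReal.ofReal (Real.exp (-ρ ^ 2 / (2 * σ ^ 2))) := by
  have hderiv (r : ℝ) : HasDerivAt (fun r => -Real.exp (-r ^ 2 / (2 * σ ^ 2)))
      (r / σ ^ 2 * Real.exp (-r ^ 2 / (2 * σ ^ 2))) r := by
    have h : HasDerivAt (fun r : ℝ => -r ^ 2 / (2 * σ ^ 2)) (-(2 * r) / (2 * σ ^ 2)) r := by
      simpa using (hasDerivAt_pow 2 r).fun_neg.div_const (2 * σ ^ 2)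
    exact h.exp.fun_neg.congr_deriv (by field_simp)
  have hnonneg : ∀ r ∈ Set.Ioi ρ, 0 ≤ r / σ ^ 2 * Real.exp (-r ^ 2 / (2 * σ ^ 2)) := by
    intro r hr
    have : 0 ≤ r := hρ.trans (le_of_lt hr)
    positivity
  have hlim : Tendsto (fun r : ℝ => -Real.exp (-r ^ 2 / (2 * σ ^ 2))) atTop (𝓝 0) := by
    rw [← neg_zero]
    refine (Real.tendsto_exp_atBot.comp ?_).neg
    refine Tendsto.atBot_div_const (by positivity) ?_
    exact tendsto_neg_atTop_atBot.comp (tendsto_pow_atTop two_ne_zero)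
  rw [← ofReal_integral_eq_lintegral_ofReal
    (integrableOn_Ioi_deriv_of_nonneg' (fun r _ => hderiv r) hnonneg hlim)
    ((ae_restrict_iff' measurableSet_Ioi).mpr (Eventually.of_forall hnonneg)),
    integral_Ioi_of_hasDerivAt_of_nonneg' (fun r _ => hderiv r) hnonneg hlim]
  congr 1
  ring

lemma complexGaussian_norm_ge (hσ : 0 < σ) {ρ : ℝ} (hρ : 0 ≤ ρ) :
    complexGaussian σ {z | ρ ≤ ‖z‖} = ENNReal.ofReal (Real.exp (-ρ ^ 2 / (2 * σ ^ 2))) := by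
  have hs : MeasurableSet {z : ℂ | ρ ≤ ‖z‖} := measurableSet_le measurable_const measurable_norm
  set c := (2 * Real.pi * σ ^ 2)⁻¹
  set G : ℝ → ENNReal := fun r => ENNReal.ofReal r *
    (ENNReal.ofReal (c * Real.exp (-r ^ 2 / (2 * σ ^ 2))) * (Set.Ici ρ).indicator 1 r)
  have hG : Measurable G := by
    refine ENNReal.measurable_ofReal.mul (Measurable.mul (by fun_prop) ?_)
    exact measurable_one.indicator measurableSet_Ici
  rw [← lintegral_indicator_one hs, lintegral_complexGaussian hσ (measurable_one.indicator hs),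
    ← Complex.lintegral_comp_polarCoord_symm]
  have h1 : ∫⁻ p in polarCoord.target, ENNReal.ofReal p.1 •
      (ENNReal.ofReal (c * Real.exp (-‖Complex.polarCoord.symm p‖ ^ 2 / (2 * σ ^ 2))) *
        {z : ℂ | ρ ≤ ‖z‖}.indicator 1 (Complex.polarCoord.symm p)) =
      ∫⁻ p in polarCoord.target, G p.1 := by
    refine setLIntegral_congr_fun polarCoord.open_target.measurableSet fun p hp => ?_
    have hp0 : 0 < p.1 := by
      rw [polarCoord_target] at hp; exact hp.1
    simp only [Complex.norm_polarCoord_symm, abs_of_pos hp0, smul_eq_mul, G, Set.indicator,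
      Set.mem_ofPred_eq, Set.mem_Ici]
    rfl
  rw [h1, polarCoord_target, Measure.volume_eq_prod, ← Measure.prod_restrict,
    lintegral_prod (fun p : ℝ × ℝ => G p.1) (hG.comp measurable_fst).aemeasurable]
  simp only [lintegral_const, Measure.restrict_apply_univ, Real.volume_Ioo]
  rw [lintegral_mul_const _ hG, ← lintegral_mul_const _ hG, ← lintegral_rayleigh hσ hρ,
    ← setLIntegral_congr (Ioi_ae_eq_Ici.symm : (Set.Ici ρ : Set ℝ) =ᵐ[volume] _),
    ← lintegral_indicator measurableSet_Ici, ← lintegral_indicator measurableSet_Ioi]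
  refine lintegral_congr_ae ?_
  -- For `ρ = 0` the half-line contains the origin, which polar coordinates omit.
  filter_upwards [Measure.ae_ne volume (0 : ℝ)] with r hr0
  by_cases hr : ρ ≤ r
  · have hr1 : 0 < r := lt_of_le_of_ne (hρ.trans hr) hr0.symm
    rw [Set.indicator_of_mem (show r ∈ Set.Ioi 0 from hr1), Set.indicator_of_mem (by exact hr)]
    simp only [G]
    rw [Set.indicator_of_mem (by exact hr), Pi.one_apply, mul_one,
      ← ENNReal.ofReal_mul hr1.le, ← ENNReal.ofReal_mul (by positivity)]
    congr 1
    simp only [c]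
    have := Real.pi_pos
    field_simp
    ring
  · rw [Set.indicator_of_notMem (s := Set.Ici ρ) (by simpa using hr)]
    by_cases hr1 : 0 < r
    · rw [Set.indicator_of_mem (show r ∈ Set.Ioi 0 from hr1)]
      simp only [G]
      rw [Set.indicator_of_notMem (s := Set.Ici ρ) (by simpa using hr)]
      simp
    · rw [Set.indicator_of_notMem (s := Set.Ioi 0) (by simpa using hr1)]

lemma complexGaussian_map_norm_sq (hσ : 0 < σ) :
    (complexGaussian σ).map (fun z => ‖z‖ ^ 2 / (2 * σ ^ 2)) = expMeasure 1 := by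
  have hm : Measurable fun z : ℂ => ‖z‖ ^ 2 / (2 * σ ^ 2) := by fun_prop
  have := Measure.isProbabilityMeasure_map (μ := complexGaussian σ) hm.aemeasurable
  refine eq_expMeasure_of_Ici one_pos fun t => ?_
  rw [Measure.map_apply hm measurableSet_Ici]
  have hset : (fun z : ℂ => ‖z‖ ^ 2 / (2 * σ ^ 2)) ⁻¹' Set.Ici t =
      {z | √(2 * σ ^ 2 * max t 0) ≤ ‖z‖} := by
    ext z
    simp only [Set.mem_preimage, Set.mem_Ici, Set.mem_ofPred_eq]
    rw [Real.sqrt_le_left (norm_nonneg z), le_div_iff₀ (by positivity)]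
    rcases le_total t 0 with h | h
    · rw [max_eq_right h]
      have : 0 ≤ σ ^ 2 := by positivity
      constructor <;> intro <;> nlinarith [sq_nonneg ‖z‖]
    · rw [max_eq_left h, mul_comm]
  rw [hset, complexGaussian_norm_ge hσ (Real.sqrt_nonneg _), Real.sq_sqrt (by positivity)]
  congr 2
  field_simp

lemma nullSingletonClass_map_norm_add (hσ : 0 < σ) (x : ℂ) :
    NullSingletonClass ((complexGaussian σ).map fun z => ‖x + z‖) := by
  refine ⟨fun r => ?_⟩
  rw [Measure.map_apply (by fun_prop) (measurableSet_singleton r)]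
  refine complexGaussian_absolutelyContinuous hσ ?_
  have : (fun z : ℂ => ‖x + z‖) ⁻¹' {r} = Metric.sphere (-x) r := by
    ext z; simp [add_comm]
  rw [this]
  exact Measure.addHaar_sphere _ _ _

lemma ae_noiseLaw_norm_add {M : ℕ} (hσ : 0 < σ) (x : Fin M → ℂ) :
    ∀ᵐ w ∂noiseLaw M σ,
      (Function.Injective fun j => ‖x j + w j‖) ∧ ∀ j, 0 < ‖x j + w j‖ := by
  have hm (j : Fin M) : Measurable fun z : ℂ => ‖x j + z‖ := by fun_prop
  have hp (j : Fin M) := Measure.isProbabilityMeasure_map (μ := complexGaussian σ) (hm j).aemeasurable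
  have hn (j : Fin M) := nullSingletonClass_map_norm_add hσ (x j)
  have hmap : (noiseLaw M σ).map (fun w j => ‖x j + w j‖) =
      Measure.pi fun j => (complexGaussian σ).map fun z => ‖x j + z‖ :=
    Measure.pi_map_pi fun j => (hm j).aemeasurable
  have hM : AEMeasurable (fun (w : Fin M → ℂ) j => ‖x j + w j‖) (noiseLaw M σ) :=
    (measurable_pi_lambda _ fun j => (hm j).comp (measurable_pi_apply j)).aemeasurable
  have h1 := ae_injective_pi (μ := fun j => (complexGaussian σ).map fun z => ‖x j + z‖)
  have h2 : ∀ᵐ y ∂Measure.pi fun j => (complexGaussian σ).map fun z => ‖x j + z‖,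
      ∀ j, y j ≠ 0 := ae_all_iff.mpr fun j => Measure.ae_eval_ne _ j 0
  rw [← hmap] at h1 h2
  filter_upwards [ae_of_ae_map hM h1, ae_of_ae_map hM h2] with w hw1 hw2
  exact ⟨hw1, fun j => lt_of_le_of_ne (norm_nonneg _) (hw2 j).symm⟩

/-- The normalised squared moduli of the coordinates picked out by an injection are independent
standard exponential variables. -/
lemma noiseLaw_map_norm_sq {M N : ℕ} (hσ : 0 < σ) {e : Fin N → Fin M}
    (he : Function.Injective e) :
    (noiseLaw M σ).map (fun w i => ‖w (e i)‖ ^ 2 / (2 * σ ^ 2)) =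
      Measure.pi fun _ : Fin N => expMeasure 1 := by
  have hp := isProbabilityMeasure_expMeasure one_pos
  have hm : Measurable fun z : ℂ => ‖z‖ ^ 2 / (2 * σ ^ 2) := by fun_prop
  have h1 : (noiseLaw M σ).map (fun w i => w (e i)) =
      Measure.pi fun _ : Fin N => complexGaussian σ := by
    have := Measure.map_infinitePi_infinitePi_of_inj (P := fun _ : Fin M => complexGaussian σ) he
    rwa [Measure.infinitePi_eq_pi, Measure.infinitePi_eq_pi] at this
  have h2 : (Measure.pi fun _ : Fin N => complexGaussian σ).map
      (fun w i => ‖w i‖ ^ 2 / (2 * σ ^ 2)) = Measure.pi fun _ : Fin N => expMeasure 1 := by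
    have := Measure.isProbabilityMeasure_map (μ := complexGaussian σ) hm.aemeasurable
    rw [Measure.pi_map_pi (f := fun _ z => ‖z‖ ^ 2 / (2 * σ ^ 2)) fun _ => hm.aemeasurable,
      complexGaussian_map_norm_sq hσ]
  rw [← h2, ← h1, Measure.map_map (by fun_prop) (by fun_prop)]
  rfl

end Density

/-! ### Limit law of the gap statistics -/

section Limit

/-- Tilting the rate `r` law by `exp(-t)` gives a multiple of the rate `r + 1` law, whose total mass
is 1. -/
lemma lintegral_exp_neg_expMeasure {r : ℝ} (hr : 0 < r) :
    ∫⁻ t, ENNReal.ofReal (Real.exp (-t)) ∂expMeasure r = ENNReal.ofReal (r / (r + 1)) := by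
  have := isProbabilityMeasure_expMeasure (r := r + 1) (by positivity)
  have h1 : ∫⁻ _, 1 ∂expMeasure (r + 1) = 1 := by simp
  rw [lintegral_expMeasure_eq measurable_const] at h1
  rw [lintegral_expMeasure_eq (by fun_prop), ← mul_one (ENNReal.ofReal (r / (r + 1))), ← h1,
    ← lintegral_const_mul _ (by fun_prop)]
  refine lintegral_congr fun t => ?_
  rw [mul_one, ← ENNReal.ofReal_mul (by positivity), ← ENNReal.ofReal_mul (by positivity),
    mul_assoc, ← Real.exp_add, add_sub_cancel_right, ← mul_assoc,
    div_mul_cancel₀ _ (by positivity)]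
  congr 3
  ring

/-- The law of a sequence of independent exponential variables with rates `1, 2, 3, …`. -/
def expSeq : Measure (ℕ → ℝ) := Measure.infinitePi fun i : ℕ => expMeasure ((i : ℝ) + 1)

lemma isProbabilityMeasure_expMeasure_succ (i : ℕ) :
    IsProbabilityMeasure (expMeasure ((i : ℝ) + 1)) :=
  isProbabilityMeasure_expMeasure (by positivity)

attribute [local instance] isProbabilityMeasure_expMeasure_succ

instance isProbabilityMeasure_expSeq : IsProbabilityMeasure expSeq := by
  unfold expSeq; infer_instance

lemma expSeq_map_fin (N : ℕ) :
    expSeq.map (fun D (i : Fin N) => D i) =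
      Measure.pi fun i : Fin N => expMeasure ((i : ℝ) + 1) := by
  have := Measure.map_infinitePi_infinitePi_of_inj
    (P := fun i : ℕ => expMeasure ((i : ℝ) + 1)) (Fin.val_injective (n := N))
  exact this.trans (Measure.infinitePi_eq_pi _)

lemma expSeq_map_eval (i : ℕ) : expSeq.map (fun D => D i) = expMeasure ((i : ℝ) + 1) :=
  Measure.infinitePi_map_eval _ i

lemma ae_expSeq_pos : ∀ᵐ D ∂expSeq, ∀ i, 0 < D i := by
  refine ae_all_iff.mpr fun i => ?_
  have h := ae_pos_expMeasure (r := (i : ℝ) + 1) (by positivity)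
  rw [← expSeq_map_eval] at h
  exact ae_of_ae_map (measurable_pi_apply i).aemeasurable h

/-- By independence the expectation is the telescoping product of `(i + 1) / (i + 2)`. -/
lemma lintegral_exp_neg_sum_expSeq (N : ℕ) :
    ∫⁻ D, ENNReal.ofReal (Real.exp (-∑ i ∈ Finset.range N, D i)) ∂expSeq =
      ENNReal.ofReal (1 / (N + 1)) := by
  have hind : iIndepFun (fun (i : ℕ) (D : ℕ → ℝ) => ENNReal.ofReal (Real.exp (-D i))) expSeq :=
    iIndepFun_infinitePi (X := fun _ x => ENNReal.ofReal (Real.exp (-x))) fun _ => by fun_prop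
  have h1 : ∫⁻ D, ENNReal.ofReal (Real.exp (-∑ i ∈ Finset.range N, D i)) ∂expSeq =
      ∏ i ∈ Finset.range N, ∫⁻ D, ENNReal.ofReal (Real.exp (-D i)) ∂expSeq := by
    rw [← lintegral_prod_eq_prod_lintegral_of_indepFun _ _ hind fun i => by fun_prop]
    refine lintegral_congr fun D => ?_
    rw [← ENNReal.ofReal_prod_of_nonneg fun _ _ => (Real.exp_pos _).le, ← Real.exp_sum,
      Finset.sum_neg_distrib]
  have h2 (i : ℕ) : ∫⁻ D, ENNReal.ofReal (Real.exp (-D i)) ∂expSeq =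
      ENNReal.ofReal (((i : ℝ) + 1) / (i + 1 + 1)) := by
    rw [← lintegral_exp_neg_expMeasure (by positivity), ← expSeq_map_eval,
      lintegral_map (by fun_prop) (measurable_pi_apply i)]
  rw [h1, Finset.prod_congr rfl fun i _ => h2 i,
    ← ENNReal.ofReal_prod_of_nonneg fun _ _ => by positivity]
  congr 1
  clear h1
  induction N with
  | zero => simp
  | succ N ih =>
    rw [Finset.prod_range_succ, ih]
    push_cast
    field_simp

/-- The infimum over `N` of `exp(-∑ D i)` has expectation at most `1 / (N + 1)` for every `N`, so it
vanishes almost surely; the partial sums are increasing and unbounded. -/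
lemma ae_expSeq_tendsto_sum :
    ∀ᵐ D ∂expSeq, Tendsto (fun N => ∑ i ∈ Finset.range N, D i) atTop atTop := by
  have hzero : ∫⁻ D, ⨅ N : ℕ, ENNReal.ofReal (Real.exp (-∑ i ∈ Finset.range N, D i)) ∂expSeq = 0 := by
    have hle (N : ℕ) := (lintegral_mono (μ := expSeq) fun D : ℕ → ℝ =>
      iInf_le (fun N : ℕ => ENNReal.ofReal (Real.exp (-∑ i ∈ Finset.range N, D i))) N).trans_eq
        (lintegral_exp_neg_sum_expSeq N)
    have hlim : Tendsto (fun N : ℕ => ENNReal.ofReal (1 / ((N : ℝ) + 1))) atTop (𝓝 0) := by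
      rw [← ENNReal.ofReal_zero]
      exact ENNReal.tendsto_ofReal tendsto_one_div_add_atTop_nhds_zero_nat
    exact le_antisymm (ge_of_tendsto' hlim hle) bot_le
  rw [lintegral_eq_zero_iff (Measurable.iInf fun N => by fun_prop)] at hzero
  filter_upwards [hzero, ae_expSeq_pos] with D hD hpos
  have hmono : Monotone fun N => ∑ i ∈ Finset.range N, D i :=
    monotone_nat_of_le_succ fun N => by
      rw [Finset.sum_range_succ]; linarith [hpos N]
  refine tendsto_atTop_atTop_of_monotone hmono fun b => ?_
  have : ⨅ N : ℕ, ENNReal.ofReal (Real.exp (-∑ i ∈ Finset.range N, D i)) <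
      ENNReal.ofReal (Real.exp (-b)) := by
    rw [show (⨅ N : ℕ, ENNReal.ofReal (Real.exp (-∑ i ∈ Finset.range N, D i))) = 0 from hD]
    exact ENNReal.ofReal_pos.mpr (Real.exp_pos _)
  obtain ⟨N, hN⟩ := iInf_lt_iff.mp this
  refine ⟨N, ?_⟩
  have := (ENNReal.ofReal_lt_ofReal_iff (Real.exp_pos _)).mp hN
  linarith [Real.exp_lt_exp.mp this]

lemma tendsto_gapStat_add {d : ℝ} (hd : 0 < d) :
    Tendsto (fun a => gapStat (a + d) a) atTop (𝓝 d) := by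
  -- Rationalising the difference of square roots gives this form of `gapStat (a + d) a`.
  have h1 : Tendsto (fun a : ℝ => 2 * d / (1 + √(1 - d / (a + d)))) atTop (𝓝 d) := by
    have h2 : Tendsto (fun a : ℝ => d / (a + d)) atTop (𝓝 0) :=
      tendsto_const_nhds.div_atTop (tendsto_atTop_add_const_right _ _ tendsto_id)
    have h3 : Tendsto (fun a : ℝ => √(1 - d / (a + d))) atTop (𝓝 1) := by
      have := (Real.continuous_sqrt.tendsto _).comp (tendsto_const_nhds (x := (1 : ℝ)).sub h2)
      simpa [Function.comp_def] using this
    have h4 := (tendsto_const_nhds (x := 2 * d)).div (tendsto_const_nhds (x := (1 : ℝ)).add h3)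
      (by norm_num)
    rw [show 2 * d / (1 + 1) = d by ring] at h4
    exact h4
  refine h1.congr' ?_
  filter_upwards [eventually_gt_atTop 0] with a ha
  have hs : 0 < √(2 * (a + d)) := Real.sqrt_pos.mpr (by positivity)
  have e1 : √(1 - d / (a + d)) = √(2 * a) / √(2 * (a + d)) := by
    rw [← Real.sqrt_div (by positivity)]
    congr 1
    field_simp
    ring
  have e2 : √(2 * (a + d)) ^ 2 = 2 * (a + d) := Real.sq_sqrt (by positivity)
  have e3 : √(2 * a) ^ 2 = 2 * a := Real.sq_sqrt (by positivity)
  have hs' := Real.sqrt_nonneg (2 * a)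
  rw [e1, gapStat]
  field_simp
  nlinarith

/-- The first `l` gap statistics of the order statistics of `u`. -/
def gapVec {N : ℕ} (l : ℕ) (u : Fin N → ℝ) (k : Fin l) : ℝ :=
  gapStat (orderStat u k) (orderStat u (k + 1))

lemma measurable_gapVec (N l : ℕ) : Measurable fun u : Fin N → ℝ => gapVec l u := by
  refine measurable_pi_lambda _ fun k => ?_
  have h1 := measurable_orderStat (ι := Fin N) k
  have h2 := measurable_orderStat (ι := Fin N) (k + 1)
  unfold gapVec gapStat
  fun_prop

lemma isSymm_gapVec (N l : ℕ) : IsSymm fun u : Fin N → ℝ => gapVec l u := by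
  intro e u
  funext k
  simp only [gapVec, orderStat_comp_equiv]

lemma tailSum_eq_sum_Ico (D : ℕ → ℝ) {N : ℕ} (k : Fin N) :
    tailSum (fun i : Fin N => D i) k = ∑ i ∈ Finset.Ico (k : ℕ) N, D i := by
  have : ∑ i : Fin N, (if (k : ℕ) ≤ i then D i else 0) = _ :=
    Fin.sum_univ_eq_sum_range (fun i => if (k : ℕ) ≤ i then D i else 0) N
  simp only [tailSum, Fin.le_def]
  rw [this, ← Finset.sum_filter]
  congr 1
  ext i
  simp [and_comm]

lemma tendsto_gapVec_tailSum {D : ℕ → ℝ} (hpos : ∀ i, 0 < D i)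
    (hD : Tendsto (fun N => ∑ i ∈ Finset.range N, D i) atTop atTop) (l : ℕ) :
    Tendsto (fun N => gapVec l (tailSum fun i : Fin N => D i)) atTop
      (𝓝 fun k : Fin l => D k) := by
  refine tendsto_pi_nhds.mpr fun k => ?_
  have hX : Tendsto (fun N => ∑ i ∈ Finset.Ico ((k : ℕ) + 1) N, D i) atTop atTop := by
    refine (tendsto_atTop_add_const_right _ (-∑ i ∈ Finset.range ((k : ℕ) + 1), D i) hD).congr' ?_
    filter_upwards [eventually_ge_atTop ((k : ℕ) + 1)] with N hN
    rw [Finset.sum_Ico_eq_sub _ hN, sub_eq_add_neg]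
  refine ((tendsto_gapStat_add (hpos k)).comp hX).congr' ?_
  filter_upwards [eventually_gt_atTop ((k : ℕ) + 1)] with N hN
  have h1 := orderStat_tailSum (D := fun i : Fin N => D i) (fun i => hpos i) ⟨k, by omega⟩
  have h2 := orderStat_tailSum (D := fun i : Fin N => D i) (fun i => hpos i) ⟨k + 1, hN⟩
  rw [tailSum_eq_sum_Ico] at h1 h2
  simp only at h1 h2
  simp only [gapVec, h1, h2, Function.comp]
  rw [Finset.sum_eq_sum_Ico_succ_bot (by omega : (k : ℕ) < N), add_comm]

open BoundedContinuousFunction in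
/-- The gap statistics of `N` independent standard exponential variables converge in law. -/
lemma tendsto_lintegral_gapVec (l : ℕ) (f : (Fin l → ℝ) →ᵇ NNReal) :
    Tendsto (fun N => ∫⁻ u, f (gapVec l u) ∂(Measure.pi fun _ : Fin N => expMeasure 1)) atTop
      (𝓝 (∫⁻ y, f y ∂(expLaw l : Measure (Fin l → ℝ)))) := by
  have hf : Measurable fun y => (f y : ENNReal) := f.continuous.measurable.coe_nnreal_ennreal
  have hrestr (N : ℕ) : Measurable fun (D : ℕ → ℝ) (i : Fin N) => D i :=
    measurable_pi_lambda _ fun i => measurable_pi_apply _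
  -- The coupling: every `N` uses the same sequence `D`, so almost sure convergence and dominated
  -- convergence apply.
  have e1 (N : ℕ) : ∫⁻ u, f (gapVec l u) ∂(Measure.pi fun _ : Fin N => expMeasure 1) =
      ∫⁻ D, f (gapVec l (tailSum fun i : Fin N => D i)) ∂expSeq := by
    have hm : Measurable fun u : Fin N → ℝ => (f (gapVec l u) : ENNReal) :=
      hf.comp (measurable_gapVec N l)
    rw [lintegral_pi_expMeasure_eq_tailSum hm, ← expSeq_map_fin,
      lintegral_map (f := fun D => (f (gapVec l (tailSum D)) : ENNReal))
        (hm.comp measurable_tailSum) (hrestr N)]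
    intro e u
    have := isSymm_gapVec N l e u
    simp only at this
    simp only [this]
  have e2 : ∫⁻ y, f y ∂(expLaw l : Measure (Fin l → ℝ)) =
      ∫⁻ D, f (fun k : Fin l => D k) ∂expSeq := by
    change ∫⁻ y, f y ∂(Measure.pi fun k : Fin l => expMeasure ((k : ℝ) + 1)) = _
    rw [← expSeq_map_fin, lintegral_map hf (hrestr l)]
  simp only [e1, e2]
  refine tendsto_lintegral_of_dominated_convergence (fun _ => (nndist f 0 : ENNReal))
    (fun N => ?_) (fun N => Eventually.of_forall fun D => ?_) ?_ ?_
  · exact hf.comp ((measurable_gapVec N l).comp (measurable_tailSum.comp (hrestr N)))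
  · exact ENNReal.coe_le_coe.mpr (NNReal.upper_bound f _)
  · simp
  · filter_upwards [ae_expSeq_pos, ae_expSeq_tendsto_sum] with D h1 h2
    have := tendsto_gapVec_tailSum h1 h2 l
    exact ENNReal.tendsto_coe.mpr ((f.continuous.tendsto _).comp this)

end Limit

/-! ### Entry of the sources and representation by exponentials -/

section Entry

/-- Union bound: dropping the cross term, `(√(2 log K) + c)² / 2 ≥ log K + c² / 2`, and `exp(-log
K)` pays for the at most `K` coordinates. -/
lemma noiseLaw_exists_norm_ge_le {M : ℕ} {σ c : ℝ} (hσ : 0 < σ) (hc : 0 ≤ c)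
    (s : Finset (Fin M)) {K : ℕ} (hK : s.card ≤ K) :
    noiseLaw M σ {w | ∃ j ∈ s, σ * (√(2 * Real.log K) + c) ≤ ‖w j‖} ≤
      ENNReal.ofReal (Real.exp (-c ^ 2 / 2)) := by
  set ρ := √(2 * Real.log K) + c
  have hρ : 0 ≤ ρ := by positivity
  have h1 (j : Fin M) : noiseLaw M σ {w | σ * ρ ≤ ‖w j‖} =
      ENNReal.ofReal (Real.exp (-ρ ^ 2 / 2)) := by
    have h := (measurePreserving_eval (fun _ : Fin M => complexGaussian σ) j).measure_preimage
      (s := {z | σ * ρ ≤ ‖z‖})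
      (measurableSet_le measurable_const measurable_norm).nullMeasurableSet
    rw [complexGaussian_norm_ge hσ (by positivity)] at h
    refine Eq.trans h ?_
    congr 2
    field_simp
  have h2 : {w : Fin M → ℂ | ∃ j ∈ s, σ * ρ ≤ ‖w j‖} = ⋃ j ∈ s, {w | σ * ρ ≤ ‖w j‖} := by
    ext; simp
  rw [h2]
  refine (measure_biUnion_finset_le _ _).trans ?_
  simp only [h1, Finset.sum_const, nsmul_eq_mul]
  -- For `K = 0` there is no coordinate to bound, while `exp(-log K) = 1 / K` would fail.
  rcases Nat.eq_zero_or_pos K with rfl | hK0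
  · have : s.card = 0 := by omega
    simp [this]
  have hK1 : (1 : ℝ) ≤ K := by exact_mod_cast hK0
  rw [← ENNReal.ofReal_natCast, ← ENNReal.ofReal_mul (by positivity)]
  refine ENNReal.ofReal_le_ofReal ?_
  have hsq : √(2 * Real.log K) ^ 2 = 2 * Real.log K :=
    Real.sq_sqrt (by have := Real.log_nonneg hK1; positivity)
  have hge : Real.log K + c ^ 2 / 2 ≤ ρ ^ 2 / 2 := by
    have : 0 ≤ √(2 * Real.log K) * c := by positivity
    simp only [ρ]
    nlinarith
  calc (s.card : ℝ) * Real.exp (-ρ ^ 2 / 2)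
      ≤ K * Real.exp (-Real.log K + -c ^ 2 / 2) := by
        gcongr
        linarith
    _ = Real.exp (-c ^ 2 / 2) := by
        rw [Real.exp_add, Real.exp_neg, Real.exp_log (by linarith)]
        field_simp

variable {M : ℕ} {A : Matrix (Fin M) (Fin M) ℂ} {σ : ℝ} {Ω : Type*} [MeasurableSpace Ω]
  {P : Measure Ω} {v : Ω → Fin M → ℂ}

lemma hasLaw_conjTranspose_mulVec (hA : Aᴴ * A = 1) (hv : HasLaw v (noiseLaw M σ) P) :
    HasLaw (fun ω => Aᴴ *ᵥ v ω) (noiseLaw M σ) P := by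
  have hm : Measurable fun w : Fin M → ℂ => Aᴴ *ᵥ w :=
    (Continuous.matrix_mulVec continuous_const continuous_id).measurable
  have := noiseLaw_map_mulVec (U := Aᴴ) σ (by rw [conjTranspose_conjTranspose, hA])
  refine ⟨hm.comp_aemeasurable hv.aemeasurable, ?_⟩
  have hcomp := AEMeasurable.map_map_of_aemeasurable hm.aemeasurable hv.aemeasurable
  rw [hv.map_eq, this] at hcomp
  exact hcomp.symm

lemma conjTranspose_mulVec_add (hA : Aᴴ * A = 1) (x y : Fin M → ℂ) :
    Aᴴ *ᵥ (A *ᵥ x + y) = fun j => x j + (Aᴴ *ᵥ y) j := by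
  rw [mulVec_add, mulVec_mulVec, hA, one_mulVec]
  rfl

lemma sourcesEnterFirst_iff (hA : Aᴴ * A = 1) (x y : Fin M → ℂ) :
    SourcesEnterFirst A (A *ᵥ x + y) x ↔
      ∀ i, x i ≠ 0 → ∀ j, x j = 0 → ‖x j + (Aᴴ *ᵥ y) j‖ < ‖x i + (Aᴴ *ᵥ y) i‖ := by
  simp only [SourcesEnterFirst, entryPoint_eq hA, conjTranspose_mulVec_add hA]

lemma nullMeasurableSet_sourcesEnterFirst (hA : Aᴴ * A = 1) (hv : HasLaw v (noiseLaw M σ) P)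
    (x : Fin M → ℂ) :
    NullMeasurableSet {ω | SourcesEnterFirst A (A *ᵥ x + v ω) x} P := by
  have hw := (hasLaw_conjTranspose_mulVec hA hv).aemeasurable
  have hm (i : Fin M) : AEMeasurable (fun ω => ‖x i + (Aᴴ *ᵥ v ω) i‖) P :=
    (by fun_prop : Measurable fun w : Fin M → ℂ => ‖x i + w i‖).comp_aemeasurable hw
  have : {ω | SourcesEnterFirst A (A *ᵥ x + v ω) x} =
      ⋂ i, ⋂ (_ : x i ≠ 0), ⋂ j, ⋂ (_ : x j = 0),
        {ω | ‖x j + (Aᴴ *ᵥ v ω) j‖ < ‖x i + (Aᴴ *ᵥ v ω) i‖} := by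
    ext ω
    simp only [sourcesEnterFirst_iff hA, Set.mem_iInter, Set.mem_ofPred_eq]
  rw [this]
  exact .iInter fun i => .iInter fun _ => .iInter fun j => .iInter fun _ =>
    nullMeasurableSet_lt (hm j) (hm i)

lemma numSources_eq_card (x : Fin M → ℂ) :
    numSources x = (Finset.univ.filter fun j => x j ≠ 0).card := by
  rw [numSources, ← Set.ncard_coe_finset]
  congr 1
  ext j
  simp

lemma measure_compl_sourcesEnterFirst_le (hA : Aᴴ * A = 1) (hσ : 0 < σ)
    (hv : HasLaw v (noiseLaw M σ) P) {x : Fin M → ℂ} {c : ℝ} (hc : 0 ≤ c)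
    (hx : ∀ j, x j ≠ 0 →
      √(2 * Real.log M) + √(2 * Real.log (numSources x)) + 2 * c ≤ ‖x j‖ / σ) :
    P {ω | SourcesEnterFirst A (A *ᵥ x + v ω) x}ᶜ ≤
      2 * ENNReal.ofReal (Real.exp (-c ^ 2 / 2)) := by
  have hw := hasLaw_conjTranspose_mulVec hA hv
  -- `E₁` and `E₂` are large noise anywhere and on the support. Off both, the margin `2 * c` is
  -- shared equally by the source's own noise and its competitor's.
  set E₁ : Set (Fin M → ℂ) :=
    {w | ∃ j ∈ Finset.univ, σ * (√(2 * Real.log M) + c) ≤ ‖w j‖}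
  set E₂ : Set (Fin M → ℂ) := {w | ∃ j ∈ Finset.univ.filter fun j => x j ≠ 0,
    σ * (√(2 * Real.log (numSources x)) + c) ≤ ‖w j‖}
  have hsub : {ω | SourcesEnterFirst A (A *ᵥ x + v ω) x}ᶜ ⊆
      (fun ω => Aᴴ *ᵥ v ω) ⁻¹' (E₁ ∪ E₂) := by
    intro ω hω
    by_contra hE
    refine hω ((sourcesEnterFirst_iff hA x (v ω)).mpr fun i hi j hj => ?_)
    simp only [Set.mem_preimage, Set.mem_union, E₁, E₂, Set.mem_ofPred_eq, not_or, not_exists,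
      not_and, not_le, Finset.mem_univ, Finset.mem_filter, true_and] at hE
    have h1 := hE.1 j
    have h2 := hE.2 i hi
    have h3 := hx i hi
    rw [le_div_iff₀ hσ] at h3
    have h4 : ‖x i‖ ≤ ‖x i + (Aᴴ *ᵥ v ω) i‖ + ‖(Aᴴ *ᵥ v ω) i‖ := by
      simpa using norm_sub_le (x i + (Aᴴ *ᵥ v ω) i) ((Aᴴ *ᵥ v ω) i)
    rw [hj, zero_add]
    linarith
  have hmap (s : Set (Fin M → ℂ)) : P ((fun ω => Aᴴ *ᵥ v ω) ⁻¹' s) ≤ noiseLaw M σ s := by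
    rw [← hw.map_eq]
    exact Measure.le_map_apply hw.aemeasurable s
  calc P {ω | SourcesEnterFirst A (A *ᵥ x + v ω) x}ᶜ ≤ noiseLaw M σ (E₁ ∪ E₂) :=
        (measure_mono hsub).trans (hmap _)
    _ ≤ noiseLaw M σ E₁ + noiseLaw M σ E₂ := measure_union_le _ _
    _ ≤ ENNReal.ofReal (Real.exp (-c ^ 2 / 2)) + ENNReal.ofReal (Real.exp (-c ^ 2 / 2)) :=
        add_le_add (noiseLaw_exists_norm_ge_le hσ hc _ (by simp))
          (noiseLaw_exists_norm_ge_le hσ hc _ (numSources_eq_card x).ge)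
    _ = _ := (two_mul _).symm

/-- The normalised squared moduli of the noise off the support of `x` are independent standard
exponential variables, and the covariance statistics past the sources are their gap statistics. -/
lemma exists_exponential_representation (hA : Aᴴ * A = 1) (hσ : 0 < σ)
    (hv : HasLaw v (noiseLaw M σ) P) (x : Fin M → ℂ) :
    ∃ u : Ω → Fin (M - numSources x) → ℝ, AEMeasurable u P ∧
      P.map u = (Measure.pi fun _ => expMeasure 1) ∧
      ∀ᵐ ω ∂P, SourcesEnterFirst A (A *ᵥ x + v ω) x → ∀ l < M - numSources x,
        (fun k : Fin l => covStat A (A *ᵥ x + v ω) σ (numSources x + (k + 1))) =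
          gapVec l (u ω) := by
  classical
  have hw := hasLaw_conjTranspose_mulVec hA hv
  have hcard : Fintype.card {j // x j = 0} = M - numSources x := by
    rw [Fintype.card_subtype, numSources_eq_card]
    have := Finset.card_filter_add_card_filter_not (s := (Finset.univ : Finset (Fin M)))
      (fun j => x j = 0)
    rw [Finset.card_univ, Fintype.card_fin] at this
    simp only [ne_eq]
    omega
  let φ := (Fintype.equivFinOfCardEq hcard).symm
  let e : Fin (M - numSources x) → Fin M := fun i => (φ i : Fin M)
  have he : Function.Injective e := Subtype.val_injective.comp φ.injective
  have hrange : Set.range e = {j | x j = 0} := by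
    have : e = Subtype.val ∘ φ := rfl
    rw [this, φ.surjective.range_comp, Subtype.range_coe_subtype]
  have hm : Measurable fun (w : Fin M → ℂ) i => ‖w (e i)‖ ^ 2 / (2 * σ ^ 2) := by fun_prop
  refine ⟨fun ω i => ‖(Aᴴ *ᵥ v ω) (e i)‖ ^ 2 / (2 * σ ^ 2), hm.comp_aemeasurable hw.aemeasurable,
    ?_, ?_⟩
  · rw [← noiseLaw_map_norm_sq hσ he, ← hw.map_eq,
      AEMeasurable.map_map_of_aemeasurable hm.aemeasurable hw.aemeasurable]
    rfl
  · have h := ae_noiseLaw_norm_add hσ x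
    rw [← hw.map_eq] at h
    filter_upwards [ae_of_ae_map hw.aemeasurable h] with ω hω hB l hl
    funext k
    refine covStat_eq_gapStat hA he hrange hσ (fun i => ?_) (fun i => by positivity) ?_ ?_ hB
      (by omega)
    · have h0 : x (e i) = 0 := (φ i).2
      simp only [conjTranspose_mulVec_add hA, h0, zero_add]
      rw [show 2 * (‖(Aᴴ *ᵥ v ω) (e i)‖ ^ 2 / (2 * σ ^ 2)) = (‖(Aᴴ *ᵥ v ω) (e i)‖ / σ) ^ 2 by
        field_simp, Real.sqrt_sq (by positivity)]
      field_simp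
    · simpa only [conjTranspose_mulVec_add hA] using hω.2
    · simpa only [conjTranspose_mulVec_add hA] using hω.1

end Entry

end CovTest

end

/-! ### Removal of the conditioning and conclusion -/

theorem mainTheorem2
    (M : ℕ → ℕ)
    (A : (n : ℕ) → Matrix (Fin (M n)) (Fin (M n)) ℂ)
    (hA : ∀ n, (A n)ᴴ * A n = 1)
    (x : (n : ℕ) → Fin (M n) → ℂ)
    (σ : ℕ → ℝ) (hσ : ∀ n, 0 < σ n)
    (Ω : ℕ → Type*) [∀ n, MeasurableSpace (Ω n)]
    (P : (n : ℕ) → Measure (Ω n)) [∀ n, IsProbabilityMeasure (P n)]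
    (v : (n : ℕ) → Ω n → Fin (M n) → ℂ)
    (hv : ∀ n, HasLaw (v n) (CovTest.noiseLaw (M n) (σ n)) (P n))
    (b : (n : ℕ) → Ω n → Fin (M n) → ℂ)
    (hb : ∀ n ω, b n ω = A n *ᵥ x n + v n ω)
    (S : ℕ → ℕ) (hS : ∀ n, S n = CovTest.numSources (x n))
    (B : (n : ℕ) → Set (Ω n))
    (hB : ∀ n, B n = {ω | CovTest.SourcesEnterFirst (A n) (b n ω) (x n)})
    (hx : ∀ C : ℝ, ∀ᶠ n in atTop, ∀ j, x n j ≠ 0 →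
      √(2 * Real.log (M n)) + √(2 * Real.log (S n)) + C ≤ ‖x n j‖ / σ n) :
    Tendsto (fun n => P n (B n)) atTop (𝓝 1) ∧
    (Tendsto (fun n => M n - S n) atTop atTop →
      ∀ l : ℕ, Tendsto
        (fun n => CovTest.condLaw (P n) (B n)
          (fun ω (k : Fin l) => CovTest.covStat (A n) (b n ω) (σ n) (S n + (k + 1))))
        atTop (𝓝 (CovTest.expLaw l))) := by

  have hBn (n : ℕ) : B n = {ω | CovTest.SourcesEnterFirst (A n) (A n *ᵥ x n + v n ω) (x n)} := by
    rw [hB]; simp only [hb]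
  have hcompl : Tendsto (fun n => P n (B n)ᶜ) atTop (𝓝 0) := by
    have hlim : Tendsto (fun c : ℝ => 2 * ENNReal.ofReal (Real.exp (-c ^ 2 / 2))) atTop (𝓝 0) := by
      have h1 : Tendsto (fun c : ℝ => Real.exp (-c ^ 2 / 2)) atTop (𝓝 0) :=
        Real.tendsto_exp_atBot.comp (Tendsto.atBot_div_const two_pos
          (tendsto_neg_atTop_atBot.comp (tendsto_pow_atTop two_ne_zero)))
      have h2 := ENNReal.Tendsto.const_mul (a := 2) (ENNReal.tendsto_ofReal h1)
        (Or.inr ENNReal.ofNat_ne_top)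
      simpa using h2
    refine ENNReal.tendsto_nhds_zero.mpr fun ε hε => ?_
    obtain ⟨c, hc, hcε⟩ :=
      ((eventually_ge_atTop (0 : ℝ)).and (ENNReal.tendsto_nhds_zero.mp hlim ε hε)).exists
    filter_upwards [hx (2 * c)] with n hn
    rw [hBn]
    refine (CovTest.measure_compl_sourcesEnterFirst_le (hA n) (hσ n) (hv n) hc ?_).trans hcε
    rwa [← hS]
  have hP : Tendsto (fun n => P n (B n)) atTop (𝓝 1) := by
    have h1 : Tendsto (fun n => 1 - P n (B n)ᶜ) atTop (𝓝 1) := by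
      simpa using ENNReal.Tendsto.sub tendsto_const_nhds hcompl (Or.inl ENNReal.one_ne_top)
    refine tendsto_of_tendsto_of_tendsto_of_le_of_le h1 tendsto_const_nhds (fun n => ?_)
      fun n => prob_le_one
    refine tsub_le_iff_right.mpr ?_
    rw [← measure_univ (μ := P n), ← Set.union_compl_self (B n)]
    exact measure_union_le _ _
  refine ⟨hP, fun hMS l => ?_⟩
  choose u hu_meas hu_map hu using fun n =>
    CovTest.exists_exponential_representation (hA n) (hσ n) (hv n) (x n)
  have hN : Tendsto (fun n => M n - CovTest.numSources (x n)) atTop atTop := by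
    simpa only [hS] using hMS
  rw [FiniteMeasure.tendsto_iff_forall_lintegral_tendsto]
  intro f
  have hf : Measurable fun y => (f y : ENNReal) := f.continuous.measurable.coe_nnreal_ennreal
  have hg (n : ℕ) : AEMeasurable (fun ω => CovTest.gapVec l (u n ω)) (P n) :=
    (CovTest.measurable_gapVec _ l).comp_aemeasurable (hu_meas n)
  have hI : Tendsto (fun n => ∫⁻ ω, f (CovTest.gapVec l (u n ω)) ∂P n) atTop
      (𝓝 (∫⁻ y, f y ∂(CovTest.expLaw l : Measure (Fin l → ℝ)))) := by
    refine ((CovTest.tendsto_lintegral_gapVec l f).comp hN).congr fun n => ?_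
    rw [Function.comp, ← hu_map n,
      lintegral_map' (f := fun y => (f (CovTest.gapVec l y) : ENNReal))
        (hf.comp (CovTest.measurable_gapVec _ l)).aemeasurable (hu_meas n)]
  -- Restricting to `B n` loses at most `sup f` times the probability of the complement.
  have hIB : Tendsto (fun n => ∫⁻ ω in B n, f (CovTest.gapVec l (u n ω)) ∂P n) atTop
      (𝓝 (∫⁻ y, f y ∂(CovTest.expLaw l : Measure (Fin l → ℝ)))) := by
    have h0 : Tendsto (fun n => (nndist f 0 : ENNReal) * P n (B n)ᶜ) atTop (𝓝 0) := by
      simpa only [mul_zero] using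
        ENNReal.Tendsto.const_mul hcompl (Or.inr (ENNReal.coe_ne_top (r := nndist f 0)))
    have h1 : Tendsto (fun n => ∫⁻ ω, f (CovTest.gapVec l (u n ω)) ∂P n -
        (nndist f 0 : ENNReal) * P n (B n)ᶜ) atTop
        (𝓝 (∫⁻ y, f y ∂(CovTest.expLaw l : Measure (Fin l → ℝ)))) := by
      simpa using ENNReal.Tendsto.sub hI h0 (Or.inr ENNReal.zero_ne_top)
    refine tendsto_of_tendsto_of_tendsto_of_le_of_le h1 hI (fun n => ?_)
      fun n => setLIntegral_le_lintegral _ _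
    refine tsub_le_iff_right.mpr ?_
    rw [← setLIntegral_univ, ← Set.union_compl_self (B n)]
    refine (lintegral_union_le _ _ _).trans ?_
    gcongr
    refine (lintegral_mono fun ω => ENNReal.coe_le_coe.mpr (BoundedContinuousFunction.NNReal.upper_bound f _)).trans ?_
    simp
  have hfinal : Tendsto (fun n => (P n (B n))⁻¹ *
      ∫⁻ ω in B n, f (CovTest.gapVec l (u n ω)) ∂P n) atTop
      (𝓝 (∫⁻ y, f y ∂(CovTest.expLaw l : Measure (Fin l → ℝ)))) := by
    have hinv : Tendsto (fun n => (P n (B n))⁻¹) atTop (𝓝 1) := by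
      simpa using tendsto_inv_iff.mpr hP
    simpa using ENNReal.Tendsto.mul hinv (Or.inl one_ne_zero) hIB (Or.inr ENNReal.one_ne_top)
  refine hfinal.congr' ?_
  -- The inequality is strict because the `l`-th gap also needs the order statistic after it.
  filter_upwards [hN.eventually_gt_atTop l] with n hn
  have hnull : NullMeasurableSet (B n) (P n) := by
    rw [hBn]
    exact CovTest.nullMeasurableSet_sourcesEnterFirst (hA n) (hv n) (x n)
  have hae : (fun ω (k : Fin l) =>
      CovTest.covStat (A n) (b n ω) (σ n) (S n + (k + 1))) =ᵐ[(P n).restrict (B n)]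
      fun ω => CovTest.gapVec l (u n ω) := by
    rw [EventuallyEq, ae_restrict_iff'₀ hnull]
    filter_upwards [hu n] with ω hω hωB
    rw [hBn] at hωB
    rw [hS, hb]
    exact hω hωB l hn
  have hae' : (fun ω (k : Fin l) =>
      CovTest.covStat (A n) (b n ω) (σ n) (S n + (k + 1))) =ᵐ[(P n)[|B n]]
      fun ω => CovTest.gapVec l (u n ω) := Measure.smul_absolutelyContinuous.ae_eq hae
  have hT := ((hg n).mono_ac cond_absolutelyContinuous).congr hae'.symm
  change _ = ∫⁻ y, f y ∂((P n)[|B n]).map _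
  rw [lintegral_map' hf.aemeasurable hT]
  refine Eq.trans ?_ (lintegral_congr_ae (hae'.fun_comp fun y => (f y : ENNReal))).symm
  rw [ProbabilityTheory.cond, lintegral_smul_measure, smul_eq_mul]
  rfl
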